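/- **Setting.** For $\mu\in(1,2]$ let $\lambda_\mu:[0,2]\to[0,2]$ be the tent map, $\lambda_\mu(x)=\mu x$ for $x\in[0,1]$ and $\lambda_\mu(x)=\mu(2-x)$ for $x\in[1,2]$. Let $\mathcal Q=[0,2]\times[0,2]$ and $\Gamma_\mu:\mathcal Q\to\mathcal Q$, $\Gamma_\mu(x,y)=(\lambda_\mu(x),\lambda_\mu(y))$. *Attractors.* Let $f:\mathcal M\to\mathcal M$, where $\mathcal M\subset\mathbb R^2$. An attractor of $f$ is a nonempty compact set $\mathcal A\subset\mathcal M$ with $f(\mathcal A)=\mathcal A$ on which $f$ is topologically transitive and whose stable set $\{z\in\mathcal M: d(f^n(z),\mathcal A)\to0\}$ has nonempty interior in $\mathcal M$. It is strange if there is $z_1\in\mathcal A$ whose orbit $\{f^n(z_1):n\ge0\}$ is dense in $\mathcal A$, at which every $f^n$ is differentiable, and for which there is $c>0$ with $\|Df^n(z_1)\|\ge e^{cn}$ for all $n\ge0$. A strange attractor has two positive Lyapunov exponents if such a $z_1$ can be chosen for which, in addition, $\lim_{n\to\infty}\frac1n\log\|Df^n(z_1)v\|$ exists and is positive for every $v\in\mathbb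 R^2\setminus\{0\}$. The map $f$ is strongly topologically mixing in $\mathcal A$ (with $f(\mathcal A)=\mathcal A$) if every nonempty relatively open $\mathcal U\subset\mathcal A$ satisfies $f^k(\mathcal U)=\mathcal A$ for some $k\in\mathbb N$. *Expanding Baker Maps.* Let $\mathcal K\subset\mathbb R^2$ be compact and convex with nonempty interior, $P\in\mathcal K$, and let $\mathcal L$ be a line with $\mathcal L\cap\operatorname{int}\mathcal K\ne\emptyset$ and $P\notin\mathcal L$. The fold $\mathcal F_{\mathcal L,P}$ is the identity on the part $\mathcal K_0$ of $\mathcal K$ lying on the side of $P$ ($\mathcal L$ included), and is the orthogonal reflection in $\mathcal L$ on the rest of $\mathcal K$; it is a good fold if $\mathcal F_{\mathcal L,P}(\mathcal K)=\mathcal K_0$. An Expanding Baker Map (EBM) on $\mathcal K$ is a map $\Gamma:\mathcal K\to\mathcal K$ of the form $\Gamma=\widetilde A\circ\mathcal F_{\mathcal L_m,P}\circ\cdots\circ\mathcal F_{\mathcal L_1,P}$ with $m\ge1$, where $P\in\mathcal K$, each $\mathcal F_{\mathcal L_i,P}$ is a good fold of the domain left by the previous folds, $\widetilde A(Q)=P+A(Q-P)$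 with $A$ linear and $|\det A|>1$, and $\widetilde A$ maps the domain left by all the folds into $\mathcal K$. *Renormalization.* A restrictive domain of $\Gamma:\mathcal K\to\mathcal K$ with return time $k\ge2$ is a set $\mathcal D\subsetneq\mathcal K$ such that $\Gamma^k(\mathcal D)\subset\mathcal D$ and $\Gamma^j(\mathcal D)\cap\operatorname{int}\mathcal D=\emptyset$ for $1\le j\le k-1$; it is strictly restrictive if even $\Gamma^j(\mathcal D)\cap\mathcal D=\emptyset$ for $1\le j\le k-1$. A map is $0$ times renormalizable on $\mathcal K$ if it is an EBM on $\mathcal K$. It is $n+1$ times renormalizable on $\mathcal K$ if it is an EBM on $\mathcal K$ and there are a restrictive domain $\mathcal D$, with return time $k$, and an invertible affine map $\varphi$ of the plane with $\varphi(\mathcal D)=\mathcal K$ such that $\varphi\circ\Gamma^k|_{\mathcal D}\circ\varphi^{-1}$ is $n$ times renormalizable on $\mathcal K$. Strictly $n$ times renormalizable is defined in the same way with strictly restrictive domains. **Lemma.** a) For every $\mu\in(\sqrt2,2]$ the map $\Gamma_\mu$ has a strange attractor with two positive Lyapunov exponents in which $\Gamma_\mu$ is strongly topologically mixing. b) For every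 integer $n\ge0$ and every $\mu\in(2^{1/2^{n+1}},2^{1/2^n}]$ the map $\Gamma_\mu$ is $n$ times renormalizable on $\mathcal Q$, and strictly $n$ times renormalizable if $\mu<2^{1/2^n}$. Moreover it has exactly $2^n$ strange attractors, and each of them has two positive Lyapunov exponents. -/

import Mathlib

open Set Filter Topology

noncomputable section

namespace TentProduct

/-- The Euclidean plane. -/
abbrev Plane : Type := EuclideanSpace ℝ (Fin 2)

/-! ### Attractors of a transformation `f` of a planar domain `M`

`f` is a map of the plane; only its values on `M` matter. -/

/-- The stable set of `A`: the points `z` of `M` with `d(f^n(z), A) → 0`. -/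
def stableSet (M : Set Plane) (f : Plane → Plane) (A : Set Plane) : Set Plane :=
  {z ∈ M | Tendsto (fun n : ℕ => Metric.infDist (f^[n] z) A) atTop (𝓝 0)}

/-- Topological transitivity of `f` on `A`, with respect to the relatively open subsets of `A`. -/
def IsTransitiveOn (f : Plane → Plane) (A : Set Plane) : Prop :=
  ∀ U V : Set Plane, IsOpen U → IsOpen V → (U ∩ A).Nonempty → (V ∩ A).Nonempty →
    ∃ n : ℕ, (f^[n] '' (U ∩ A) ∩ (V ∩ A)).Nonempty

/-- An attractor: a nonempty compact invariant transitive subset of `M` whose stable set has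
nonempty interior relative to `M`. -/
structure IsAttractor (M : Set Plane) (f : Plane → Plane) (A : Set Plane) : Prop where
  subset : A ⊆ M
  nonempty : A.Nonempty
  isCompact : IsCompact A
  invariant : f '' A = A
  transitive : IsTransitiveOn f A
  stable : ∃ U : Set Plane, IsOpen U ∧ (U ∩ M).Nonempty ∧ U ∩ M ⊆ stableSet M f A

/-- The forward orbit of `z` is dense in `A`, and every iterate of `f` is differentiable at `z`
(along `M`). -/
structure IsDenseSmoothOrbit (M : Set Plane) (f : Plane → Plane) (A : Set Plane) (z : Plane) :
    Prop where
  mem : z ∈ A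
  dense : A ⊆ closure {w | ∃ n : ℕ, w = f^[n] z}
  differentiable : ∀ n : ℕ, DifferentiableWithinAt ℝ f^[n] M z

/-- Exponential growth of the derivative along the orbit of `z`. -/
def HasExponentialGrowth (M : Set Plane) (f : Plane → Plane) (z : Plane) : Prop :=
  ∃ c : ℝ, 0 < c ∧ ∀ n : ℕ, Real.exp (c * n) ≤ ‖fderivWithin ℝ f^[n] M z‖

/-- Both Lyapunov exponents at `z` exist and are positive: every nonzero tangent vector `v` has a
positive exponent `lim (1 / n) log ‖Df^n(z) v‖`. -/
def HasTwoPositiveExponentsAt (M : Set Plane) (f : Plane → Plane) (z : Plane) : Prop :=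
  ∀ v : Plane, v ≠ 0 → ∃ χ : ℝ, 0 < χ ∧
    Tendsto (fun n : ℕ => (1 / (n : ℝ)) * Real.log ‖fderivWithin ℝ f^[n] M z v‖) atTop (𝓝 χ)

/-- A strange attractor: an attractor containing a dense orbit with exponential growth of the
derivative. -/
def IsStrangeAttractor (M : Set Plane) (f : Plane → Plane) (A : Set Plane) : Prop :=
  IsAttractor M f A ∧ ∃ z, IsDenseSmoothOrbit M f A z ∧ HasExponentialGrowth M f z

/-- A strange attractor with two positive Lyapunov exponents: the dense orbit with exponential
growth of the derivative can be chosen with two positive Lyapunov exponents. -/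
def IsStrangeAttractorWithTwoPositiveExponents (M : Set Plane) (f : Plane → Plane)
    (A : Set Plane) : Prop :=
  IsAttractor M f A ∧
    ∃ z, IsDenseSmoothOrbit M f A z ∧ HasExponentialGrowth M f z ∧
      HasTwoPositiveExponentsAt M f z

/-- `f` is strongly topologically mixing in the invariant set `A`: every nonempty relatively open
subset of `A` is mapped onto `A` by some iterate of `f`. -/
def IsStronglyMixingOn (f : Plane → Plane) (A : Set Plane) : Prop :=
  f '' A = A ∧ ∀ U : Set Plane, IsOpen U → (U ∩ A).Nonempty → ∃ k : ℕ, f^[k] '' (U ∩ A) = A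

/-! ### Expanding Baker Maps -/

/-- A line of the plane in normal form `⟪normal, Q⟫ = offset`. -/
structure Line where
  normal : Plane
  offset : ℝ
  normal_ne_zero : normal ≠ 0

/-- A signed multiple of the distance to the line. -/
def Line.eval (L : Line) (Q : Plane) : ℝ := inner ℝ L.normal Q - L.offset

/-- The points of the line. -/
def Line.carrier (L : Line) : Set Plane := {Q | L.eval Q = 0}

/-- The closed half-plane bounded by `L` that contains `P` (for `P` not on `L`). -/
def Line.side (L : Line) (P : Plane) : Set Plane := {Q | 0 ≤ L.eval P * L.eval Q}

/-- The symmetric point of `Q` with respect to `L`. -/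
def Line.symm (L : Line) (Q : Plane) : Plane :=
  Q - (2 * L.eval Q / ‖L.normal‖ ^ 2) • L.normal

open Classical in
/-- The fold along `L` that fixes the side of `P`. -/
def fold (L : Line) (P : Plane) (Q : Plane) : Plane :=
  if Q ∈ L.side P then Q else L.symm Q

/-- The composition `F_{L_n,P} ∘ ⋯ ∘ F_{L_1,P}` for the list `[L_1, …, L_n]`. -/
def foldAll (P : Plane) : List Line → Plane → Plane
  | [], Q => Q
  | L :: Ls, Q => foldAll P Ls (fold L P Q)

/-- The domain `K_{0⋯0}` that is left of `K` after the folds along `[L_1, …, L_n]`. -/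
def foldedDomain (P : Plane) : List Line → Set Plane → Set Plane
  | [], K => K
  | L :: Ls, K => foldedDomain P Ls (K ∩ L.side P)

/-- `[L_1, …, L_n]` defines a sequence of good folds of `K` with base point `P`: each line meets
the interior of the current domain, avoids `P`, and the fold along it maps the current domain
onto its part on the side of `P`, which is the next domain. -/
def AreGoodFolds (P : Plane) : List Line → Set Plane → Prop
  | [], _ => True
  | L :: Ls, K => (L.carrier ∩ interior K).Nonempty ∧ P ∉ L.carrier ∧
      fold L P '' K = K ∩ L.side P ∧ AreGoodFolds P Ls (K ∩ L.side P)

/-- `Γ` is, on the compact convex domain `K` with nonempty interior, an Expanding Baker Map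
`EBM(K, L_1, …, L_n, P, A)`. -/
def IsEBM (K : Set Plane) (Γ : Plane → Plane) : Prop :=
  IsCompact K ∧ Convex ℝ K ∧ (interior K).Nonempty ∧
    ∃ (P : Plane) (Ls : List Line) (A : Plane →ₗ[ℝ] Plane),
      P ∈ K ∧ Ls ≠ [] ∧ AreGoodFolds P Ls K ∧ 1 < |LinearMap.det A| ∧
      (∀ Q ∈ foldedDomain P Ls K, P + A (Q - P) ∈ K) ∧
      ∀ Q ∈ K, Γ Q = P + A (foldAll P Ls Q - P)

/-! ### Renormalization -/

/-- `D` is a restrictive domain of `Γ : K → K` with return time `k`: it is a proper subset of `K`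
that is mapped into itself by `Γ^k` (`k ≥ 2`), and its intermediate images do not meet its
interior. -/
structure IsRestrictiveDomain (K : Set Plane) (Γ : Plane → Plane) (D : Set Plane) (k : ℕ) :
    Prop where
  subset : D ⊆ K
  ne : D ≠ K
  two_le : 2 ≤ k
  disjoint : ∀ j : ℕ, 1 ≤ j → j ≤ k - 1 → Disjoint (Γ^[j] '' D) (interior D)
  mapsTo : MapsTo Γ^[k] D D

/-- A strictly restrictive domain: the intermediate images of `D` do not even meet `D`. -/
structure IsStrictlyRestrictiveDomain (K : Set Plane) (Γ : Plane → Plane) (D : Set Plane)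
    (k : ℕ) : Prop where
  subset : D ⊆ K
  ne : D ≠ K
  two_le : 2 ≤ k
  disjoint : ∀ j : ℕ, 1 ≤ j → j ≤ k - 1 → Disjoint (Γ^[j] '' D) D
  mapsTo : MapsTo Γ^[k] D D

/-- `Γ` is an `n` times renormalizable Expanding Baker Map on `K`, with domains that are
restrictive in the sense of `R`. For `n + 1`: `Γ` is an EBM on `K` and there are a restrictive
domain `D` with return time `k` and an affine change of coordinates `φ` with `φ(D) = K` such that
the return map `Γ^k` on `D`, read on `K` in the coordinates `φ`, is an `n` times renormalizable
EBM on `K` (in particular, for `n = 0`, an EBM on `K`). -/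
def IsRenormalizableTimes
    (R : Set Plane → (Plane → Plane) → Set Plane → ℕ → Prop) (K : Set Plane) :
    ℕ → (Plane → Plane) → Prop
  | 0, Γ => IsEBM K Γ
  | n + 1, Γ => IsEBM K Γ ∧ ∃ (D : Set Plane) (k : ℕ) (φ : Plane ≃ᵃ[ℝ] Plane),
      R K Γ D k ∧ φ '' D = K ∧
        IsRenormalizableTimes R K n (fun Q => φ (Γ^[k] (φ.symm Q)))

/-! ### The product of tent maps -/

/-- The tent map `λ_μ` on `[0, 2]`. -/
def tent (μ : ℝ) (x : ℝ) : ℝ := if x ≤ 1 then μ * x else μ * (2 - x)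

/-- The square `[0, 2] × [0, 2]`. -/
def square : Set Plane := {p | p 0 ∈ Icc (0 : ℝ) 2 ∧ p 1 ∈ Icc (0 : ℝ) 2}

/-- `Γ_μ (x, y) = (λ_μ x, λ_μ y)`, considered on `square`. -/
def tentProduct (μ : ℝ) (p : Plane) : Plane := !₂[tent μ (p 0), tent μ (p 1)]

end TentProduct

end

/-! Both coordinates evolve independently under the same tent map, so the planar statements reduce
to interval dynamics.

Renormalization: the maps `x ↦ 1 + c - ν|x - 1|` form a family closed under renormalization. Near
the peak the second iterate is a valley of slope `ν²`, and a homothety of negative ratio turns it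
into the member with parameters `(ν², 1)`. The return domain exists exactly as long as `ν² ≤ 2`, so
`μ ^ 2 ^ n ≤ 2` allows `n` steps (`peakProduct_renormalization`,
`isRenormalizableTimes_peakProduct`).

Attractors: for `2 < μ ^ 2 ^ (n + 1)` the tent map has a cycle of `N = 2 ^ n` intervals `J i`, and
every interval eventually covers one of them (`exists_isIntervalCycle`). The products `J i × J j`
are permuted with `j - i` constant modulo `N`, which splits them into the `N` sets `diagonal J d`.
Covering makes each of these transitive, and Baire gives a point with dense orbit that never meets
the lines of non-differentiability. There the derivative of the `n`-th iterate multiplies all norms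
by `μ ^ n`, so both exponents are `log μ`. Conversely, the basin of any attractor eventually covers
a product `J i × J j`, which forces the attractor to be a `diagonal J d` (`exists_eq_diagonal`). -/

namespace TentProduct

/-! ### Renormalization of products of unimodal piecewise linear maps -/

/-- The product of two copies of `x ↦ 1 + c - ν |x - 1|`. -/
noncomputable def peakProduct (ν c : ℝ) (p : Plane) : Plane :=
  !₂[1 + (c - ν * |p 0 - 1|), 1 + (c - ν * |p 1 - 1|)]

theorem peakProduct_apply (ν c : ℝ) (p : Plane) (i : Fin 2) :
    peakProduct ν c p i = 1 + (c - ν * |p i - 1|) := by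
  fin_cases i <;> simp [peakProduct]

theorem tent_eq (μ x : ℝ) : tent μ x = μ * (1 - |x - 1|) := by
  unfold tent
  split_ifs with h
  · rw [abs_of_nonpos (by linarith)]; ring
  · rw [abs_of_nonneg (by linarith)]; ring

theorem tentProduct_apply (μ : ℝ) (p : Plane) (i : Fin 2) :
    tentProduct μ p i = tent μ (p i) := by
  fin_cases i <;> simp [tentProduct]

theorem tentProduct_eq_peakProduct (μ : ℝ) : tentProduct μ = peakProduct μ (μ - 1) := by
  funext p
  ext i
  rw [tentProduct_apply, peakProduct_apply, tent_eq]
  ring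

/-! ### The square and its folds along the two medians -/

theorem mem_square {p : Plane} : p ∈ square ↔ ∀ i, |p i - 1| ≤ 1 := by
  simp only [square, mem_ofPred_eq, mem_Icc, Fin.forall_fin_two, abs_le]
  constructor <;> rintro ⟨⟨_, _⟩, _, _⟩ <;> refine ⟨⟨?_, ?_⟩, ?_, ?_⟩ <;> linarith

theorem square_eq_preimage :
    square = (EuclideanSpace.equiv (Fin 2) ℝ) ⁻¹' (Set.univ.pi fun _ => Icc (0 : ℝ) 2) := by
  ext p
  rw [mem_preimage, Set.mem_univ_pi, Fin.forall_fin_two]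
  rfl

theorem convex_square : Convex ℝ square := by
  rw [square_eq_preimage]
  exact (convex_pi fun _ _ => convex_Icc _ _).linear_preimage
    (EuclideanSpace.equiv (Fin 2) ℝ).toLinearEquiv.toLinearMap

theorem isCompact_square : IsCompact square := by
  rw [square_eq_preimage]
  exact (EuclideanSpace.equiv (Fin 2) ℝ).toHomeomorph.isCompact_preimage.2
    (isCompact_univ_pi fun _ => isCompact_Icc)

theorem isOpen_box (a b c d : ℝ) : IsOpen {p : Plane | p 0 ∈ Ioo a b ∧ p 1 ∈ Ioo c d} :=
  (isOpen_Ioo.preimage (by fun_prop : Continuous fun p : Plane => p 0)).inter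
    (isOpen_Ioo.preimage (by fun_prop : Continuous fun p : Plane => p 1))

/-- The line on which the `i`-th coordinate is `1`. -/
noncomputable def axisLine (i : Fin 2) : Line where
  normal := EuclideanSpace.single i 1
  offset := 1
  normal_ne_zero := by simp

theorem axisLine_eval (i : Fin 2) (Q : Plane) : (axisLine i).eval Q = Q i - 1 := by
  simp [axisLine, Line.eval, EuclideanSpace.inner_single_left]

theorem mem_axisLine_side {i : Fin 2} {P Q : Plane} (hP : 1 < P i) :
    Q ∈ (axisLine i).side P ↔ 1 ≤ Q i := by
  simp only [Line.side, mem_ofPred_eq, axisLine_eval]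
  rw [mul_nonneg_iff_of_pos_left (by linarith), sub_nonneg]

theorem fold_axisLine_apply_self {i : Fin 2} {P : Plane} (hP : 1 < P i) (Q : Plane) :
    fold (axisLine i) P Q i = 1 + |Q i - 1| := by
  unfold fold
  rw [mem_axisLine_side hP]
  split_ifs with h
  · rw [abs_of_nonneg (by linarith)]; ring
  · rw [abs_of_nonpos (by linarith)]
    simp [Line.symm, axisLine_eval]
    simp [axisLine]
    ring

theorem fold_axisLine_apply_ne {i j : Fin 2} (hij : j ≠ i) (P Q : Plane) :
    fold (axisLine i) P Q j = Q j := by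
  unfold fold
  split_ifs with h
  · rfl
  · simp [Line.symm, axisLine, hij]

theorem fold_axisLine_image {i : Fin 2} {P : Plane} (hP : 1 < P i) {K : Set Plane}
    (hK : MapsTo (fold (axisLine i) P) K K) :
    fold (axisLine i) P '' K = K ∩ (axisLine i).side P := by
  ext Q
  constructor
  · rintro ⟨R, hR, rfl⟩
    refine ⟨hK hR, ?_⟩
    rw [mem_axisLine_side hP, fold_axisLine_apply_self hP]
    linarith [abs_nonneg (R i - 1)]
  · rintro ⟨hQ, hs⟩
    exact ⟨Q, hQ, by simp [fold, hs]⟩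

theorem mapsTo_fold_square {i : Fin 2} {P : Plane} (hP : 1 < P i) :
    MapsTo (fold (axisLine i) P) square square := by
  intro Q hQ
  rw [mem_square] at hQ ⊢
  intro j
  rcases eq_or_ne j i with rfl | h
  · rw [fold_axisLine_apply_self hP]
    simpa using hQ j
  · rw [fold_axisLine_apply_ne h]
    exact hQ j

/-- Folding along both medians replaces `Q i` by `1 + |Q i - 1|`; on the remaining quarter the map
is affine with linear part `-ν`, centred at its fixed point. The bound `ν - 1 ≤ c` keeps the image
above `0`, and `c ≤ 1` keeps it below `2`. -/
theorem isEBM_peakProduct {ν c : ℝ} (hν : 1 < ν) (hc : ν - 1 ≤ c) (hc1 : c ≤ 1)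
    {Γ : Plane → Plane} (hΓ : EqOn Γ (peakProduct ν c) square) : IsEBM square Γ := by
  -- `q = c / (1 + ν)` solves `c - ν q = q`, so `1 + q` is the fixed point on the decreasing branch.
  have hq : 0 < c / (1 + ν) := div_pos (by linarith) (by linarith)
  have hq1 : c / (1 + ν) ≤ 1 := by rw [div_le_one (by linarith)]; linarith
  have hqe : c / (1 + ν) * (1 + ν) = c := div_mul_cancel₀ _ (by linarith)
  set q := c / (1 + ν)
  set P : Plane := !₂[1 + q, 1 + q] with hPdef
  have hPi : ∀ i, P i = 1 + q := by intro i; fin_cases i <;> simp [P]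
  have hP : ∀ i, 1 < P i := fun i => by rw [hPi]; linarith
  have hside : ∀ {i Q}, Q ∈ (axisLine i).side P ↔ 1 ≤ Q i := fun {i Q} =>
    mem_axisLine_side (hP i)
  have hPL : ∀ i, P ∉ (axisLine i).carrier := by
    intro i h
    have : P i - 1 = 0 := by simpa [Line.carrier, axisLine_eval] using h
    linarith [hP i]
  have int0 : (!₂[1, 1] : Plane) ∈ interior square := by
    refine mem_interior.2 ⟨_, fun p hp => ?_, isOpen_box 0 2 0 2, ?_⟩
    · exact ⟨Ioo_subset_Icc_self hp.1, Ioo_subset_Icc_self hp.2⟩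
    · norm_num
  have int1 : (!₂[3 / 2, 1] : Plane) ∈ interior (square ∩ (axisLine 0).side P) := by
    refine mem_interior.2 ⟨_, fun p hp => ?_, isOpen_box 1 2 0 2, ?_⟩
    · refine ⟨⟨⟨by linarith [hp.1.1], hp.1.2.le⟩, Ioo_subset_Icc_self hp.2⟩, ?_⟩
      exact hside.2 hp.1.1.le
    · norm_num
  refine ⟨isCompact_square, convex_square, ⟨_, int0⟩, P, [axisLine 0, axisLine 1],
    (-ν) • LinearMap.id, ?_, by simp, ?_, ?_, ?_, ?_⟩
  · rw [mem_square]
    intro i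
    rw [hPi, abs_le]
    constructor <;> linarith
  · refine ⟨⟨_, ?_, int0⟩, hPL 0, fold_axisLine_image (hP 0) (mapsTo_fold_square (hP 0)),
      ⟨_, ?_, int1⟩, hPL 1, fold_axisLine_image (hP 1) ?_, trivial⟩
    · simp [Line.carrier, axisLine_eval]
    · simp [Line.carrier, axisLine_eval]
    · rintro Q ⟨hQ, hs⟩
      refine ⟨mapsTo_fold_square (hP 1) hQ, ?_⟩
      rw [hside] at hs ⊢
      rwa [fold_axisLine_apply_ne (by decide)]
  · rw [LinearMap.det_smul, LinearMap.det_id]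
    simp
    exact hν.trans_le (le_abs_self ν)
  · intro Q hQ
    obtain ⟨⟨hQ, h0⟩, h1⟩ : (Q ∈ square ∧ Q ∈ (axisLine 0).side P) ∧ Q ∈ (axisLine 1).side P := hQ
    rw [hside] at h0 h1
    rw [mem_square] at hQ ⊢
    have h : ∀ i, 1 ≤ Q i := by rw [Fin.forall_fin_two]; exact ⟨h0, h1⟩
    intro i
    have h2 := abs_le.1 (hQ i)
    have h3 := h i
    simp [hPi]
    rw [abs_le]
    constructor <;> nlinarith
  · intro Q hQ
    rw [hΓ hQ]
    ext i
    rw [peakProduct_apply]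
    have : foldAll P [axisLine 0, axisLine 1] Q i = 1 + |Q i - 1| := by
      simp only [foldAll]
      fin_cases i
      · simp only [Fin.zero_eta]
        rw [fold_axisLine_apply_ne (by decide), fold_axisLine_apply_self (hP 0)]
      · simp only [Fin.mk_one]
        rw [fold_axisLine_apply_self (hP 1), fold_axisLine_apply_ne (by decide)]
    simp [this, hPi]
    linear_combination -hqe

/-- The square with centre `(1, 1)` and half-side `r`. -/
def centralSquare (r : ℝ) : Set Plane := {p | ∀ i, |p i - 1| ≤ r}

theorem mapsTo_peakProduct_square {ν c : ℝ} (hν : 1 < ν) (hc : ν - 1 ≤ c) (hc1 : c ≤ 1) :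
    MapsTo (peakProduct ν c) square square := by
  intro p hp
  rw [mem_square] at hp ⊢
  intro i
  have := hp i
  have := abs_nonneg (p i - 1)
  rw [peakProduct_apply, abs_le]
  constructor <;> nlinarith

/-- The second iterate of the peak map near the peak. -/
theorem peakProduct_peakProduct_apply {ν c : ℝ} {p : Plane} {i : Fin 2}
    (h : ν * |p i - 1| ≤ c) :
    peakProduct ν c (peakProduct ν c p) i = 1 - (c * (ν - 1) - ν ^ 2 * |p i - 1|) := by
  rw [peakProduct_apply, peakProduct_apply, add_sub_cancel_left, abs_of_nonneg (by linarith)]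
  ring

/-- The domain is the central square of half-side `r = c (ν - 1)`, chosen so that the second iterate
sends the centre to the corner `(1 - r, 1 - r)`. It is in general smaller than the square with a
corner at the fixed point, whose first image always touches it; this is what gives strictness for
`ν² < 2`. -/
theorem peakProduct_renormalization {ν c : ℝ} (hν : 1 < ν) (hν2 : ν ^ 2 ≤ 2) (hc : ν - 1 ≤ c)
    (hc1 : c ≤ 1) {Γ : Plane → Plane} (hΓ : EqOn Γ (peakProduct ν c) square) :
    ∃ (D : Set Plane) (φ : Plane ≃ᵃ[ℝ] Plane), IsRestrictiveDomain square Γ D 2 ∧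
      (ν ^ 2 < 2 → IsStrictlyRestrictiveDomain square Γ D 2) ∧ φ '' D = square ∧
      EqOn (fun Q => φ (Γ^[2] (φ.symm Q))) (peakProduct (ν ^ 2) 1) square := by
  have hcpos : 0 < c := by linarith
  have hr : 0 < c * (ν - 1) := mul_pos hcpos (by linarith)
  have hν15 : ν < 3 / 2 := by nlinarith
  have hr1 : c * (ν - 1) < 1 := by nlinarith
  have hνr : ν * (c * (ν - 1)) ≤ c := by nlinarith
  -- The first image has coordinates at least `1 + c - ν r`, and `r ≤ c - ν r` means `c (ν² - 1) ≤
  -- c`, that is `ν² ≤ 2`.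
  have hgap : c * (ν - 1) ≤ c - ν * (c * (ν - 1)) := by nlinarith
  have hgap' : ν ^ 2 < 2 → c * (ν - 1) < c - ν * (c * (ν - 1)) := fun h => by nlinarith
  obtain ⟨r, hrdef⟩ : ∃ r, r = c * (ν - 1) := ⟨_, rfl⟩
  rw [← hrdef] at hr hr1 hνr hgap hgap'
  have hsub : centralSquare r ⊆ square := fun p hp => mem_square.2 fun i => (hp i).trans hr1.le
  have hne : centralSquare r ≠ square := by
    intro h
    have : (!₂[2, 2] : Plane) ∈ square := by norm_num [square]
    rw [← h] at this
    have := this 0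
    norm_num at this
    linarith
  have hΓ1 : ∀ p ∈ centralSquare r, ∀ i, c - ν * r ≤ Γ p i - 1 := by
    intro p hp i
    rw [hΓ (hsub hp), peakProduct_apply]
    have := mul_le_mul_of_nonneg_left (hp i) (by linarith : 0 ≤ ν)
    linarith
  have hΓ2 : ∀ p ∈ centralSquare r, ∀ i, Γ^[2] p i = 1 - (r - ν ^ 2 * |p i - 1|) := by
    intro p hp i
    have h1 : Γ^[2] p = peakProduct ν c (peakProduct ν c p) := by
      change Γ (Γ p) = _
      rw [hΓ (hsub hp), hΓ (mapsTo_peakProduct_square hν hc hc1 (hsub hp))]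
    rw [h1, peakProduct_peakProduct_apply, hrdef]
    exact (mul_le_mul_of_nonneg_left (hp i) (by linarith)).trans hνr
  have hmaps : MapsTo Γ^[2] (centralSquare r) (centralSquare r) := by
    intro p hp i
    have := hp i
    have := abs_nonneg (p i - 1)
    rw [hΓ2 p hp, abs_le]
    constructor <;> nlinarith
  -- An interior point can be moved slightly to the right inside the square, so its first coordinate
  -- is strictly below `1 + r`.
  have hint : interior (centralSquare r) ⊆ {p | p 0 - 1 < r} := by
    intro p hp
    have hcont : Tendsto (fun t : ℝ => p + t • EuclideanSpace.single (0 : Fin 2) (1 : ℝ))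
        (𝓝[>] 0) (𝓝 p) := by
      have : Continuous (fun t : ℝ => p + t • EuclideanSpace.single (0 : Fin 2) (1 : ℝ)) := by
        fun_prop
      simpa using (this.tendsto 0).mono_left nhdsWithin_le_nhds
    have h1 := hcont.eventually (mem_interior_iff_mem_nhds.1 hp)
    obtain ⟨t, ht, ht0⟩ := (h1.and self_mem_nhdsWithin).exists
    have h2 := (abs_le.1 (ht 0)).2
    have h3 : (0 : ℝ) < t := ht0
    simp at h2
    simp only [mem_ofPred_eq]
    linarith
  have hu : -r ≠ 0 := by linarith
  set O : Plane := !₂[1, 1] with hO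
  have hOi : ∀ i, O i = 1 := by intro i; fin_cases i <;> simp [O]
  -- The ratio is negative because the second iterate has a minimum at the centre, to be turned into
  -- a peak.
  set φ : Plane ≃ᵃ[ℝ] Plane := (AffineEquiv.homothetyUnitsMulHom O (Units.mk0 (-r) hu)).symm
    with hφ
  have hφs : ∀ Q i, φ.symm Q i = 1 - r * (Q i - 1) := by
    intro Q i
    change AffineMap.homothety O (-r) Q i = _
    simp [AffineMap.homothety_apply, hOi]
    ring
  have hφi : ∀ Q i, φ Q i = 1 - (Q i - 1) / r := by
    intro Q i
    have := hφs (φ Q) i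
    rw [AffineEquiv.symm_apply_apply] at this
    field_simp
    linarith
  have hφD : ∀ Q ∈ square, φ.symm Q ∈ centralSquare r := by
    intro Q hQ i
    rw [mem_square] at hQ
    rw [hφs, show 1 - r * (Q i - 1) - 1 = -(r * (Q i - 1)) by ring, abs_neg, abs_mul,
      abs_of_pos hr]
    nlinarith [hQ i]
  refine ⟨centralSquare r, φ, ⟨hsub, hne, le_rfl, ?_, hmaps⟩,
    fun h => ⟨hsub, hne, le_rfl, ?_, hmaps⟩, ?_, ?_⟩
  · intro j h1 h2
    obtain rfl : j = 1 := by omega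
    rw [Set.disjoint_left]
    rintro _ ⟨p, hp, rfl⟩ h3
    have h4 : Γ p 0 - 1 < r := hint h3
    linarith [hΓ1 p hp 0]
  · intro j h1 h2
    obtain rfl : j = 1 := by omega
    rw [Set.disjoint_left]
    rintro _ ⟨p, hp, rfl⟩ h3
    have h4 : |Γ p 0 - 1| ≤ r := h3 0
    linarith [hΓ1 p hp 0, le_abs_self (Γ p 0 - 1), hgap' h]
  · ext Q
    constructor
    · rintro ⟨p, hp, rfl⟩
      rw [mem_square]
      intro i
      rw [hφi, show 1 - (p i - 1) / r - 1 = -((p i - 1) / r) by ring, abs_neg, abs_div,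
        abs_of_pos hr, div_le_one hr]
      exact hp i
    · intro hQ
      exact ⟨φ.symm Q, hφD Q hQ, φ.apply_symm_apply Q⟩
  · intro Q hQ
    ext i
    change φ (Γ^[2] (φ.symm Q)) i = _
    rw [hφi, hΓ2 _ (hφD Q hQ), hφs, peakProduct_apply,
      show 1 - r * (Q i - 1) - 1 = -(r * (Q i - 1)) by ring, abs_neg, abs_mul, abs_of_pos hr]
    field_simp
    ring

theorem sq_le_of_pow_two_pow_le {ν : ℝ} (hν : 1 < ν) (n : ℕ) : ν ^ 2 ≤ ν ^ 2 ^ (n + 1) :=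
  pow_le_pow_right₀ hν.le (by rw [pow_succ]; nlinarith [Nat.one_le_two_pow (n := n)])

/-- The induction needs general `c` and a map agreeing with `peakProduct` only on the square: the
renormalized map has `c = 1`, whereas the tent map has `c = μ - 1`, and the conjugacy holds only
there. -/
theorem isRenormalizableTimes_peakProduct (n : ℕ) {ν c : ℝ} (hν : 1 < ν) (hn : ν ^ 2 ^ n ≤ 2)
    (hc : ν - 1 ≤ c) (hc1 : c ≤ 1) {Γ : Plane → Plane} (hΓ : EqOn Γ (peakProduct ν c) square) :
    IsRenormalizableTimes IsRestrictiveDomain square n Γ ∧ (ν ^ 2 ^ n < 2 →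
      IsRenormalizableTimes IsStrictlyRestrictiveDomain square n Γ) := by
  induction n generalizing ν c Γ with
  | zero => exact ⟨isEBM_peakProduct hν hc hc1 hΓ, fun _ => isEBM_peakProduct hν hc hc1 hΓ⟩
  | succ n ih =>
    have h2 := sq_le_of_pow_two_pow_le hν n
    obtain ⟨D, φ, hD, hD', hφ, hconj⟩ :=
      peakProduct_renormalization hν (h2.trans hn) hc hc1 hΓ
    have hpow : (ν ^ 2) ^ 2 ^ n = ν ^ 2 ^ (n + 1) := by rw [← pow_mul, pow_succ' 2 n]
    have := ih (ν := ν ^ 2) (c := 1) (by nlinarith) (by rwa [hpow]) (by linarith) le_rfl hconj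
    rw [hpow] at this
    exact ⟨⟨isEBM_peakProduct hν hc hc1 hΓ, D, 2, φ, hD, hφ, this.1⟩,
      fun h => ⟨isEBM_peakProduct hν hc hc1 hΓ, D, 2, φ, hD' (h2.trans_lt h), hφ, this.2 h⟩⟩

/-! ### Cycles of intervals of the tent map -/

theorem continuous_tent (μ : ℝ) : Continuous (tent μ) := by
  rw [show tent μ = fun x => μ * (1 - |x - 1|) from funext (tent_eq μ)]
  fun_prop

theorem mapsTo_tent {μ : ℝ} (h0 : 0 ≤ μ) (h2 : μ ≤ 2) :
    MapsTo (tent μ) (Icc 0 2) (Icc 0 2) := by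
  intro x hx
  have h : |x - 1| ≤ 1 := abs_le.2 ⟨by linarith [hx.1], by linarith [hx.2]⟩
  have := abs_nonneg (x - 1)
  rw [tent_eq]
  constructor <;> nlinarith

theorem tent_of_le {μ x : ℝ} (h : x ≤ 1) : tent μ x = μ * x := if_pos h

theorem tent_of_ge {μ x : ℝ} (h : 1 ≤ x) : tent μ x = μ * (2 - x) := by
  rw [tent_eq, abs_of_nonneg (by linarith)]
  ring

/-- A cycle of `N` nontrivial compact intervals in `[0, 2]` which are permuted by `f` and pairwise
meet in at most one point, and one of which is covered by some iterate of any given interval. -/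
structure IsIntervalCycle (f : ℝ → ℝ) (N : ℕ) (J : ℕ → Set ℝ) : Prop where
  pos : 0 < N
  isCompact : ∀ i, IsCompact (J i)
  isPreconnected : ∀ i, IsPreconnected (J i)
  nontrivial : ∀ i, (J i).Nontrivial
  subset : ∀ i, J i ⊆ Icc 0 2
  image : ∀ i, f '' J i = J (i + 1)
  periodic : ∀ i, J (i + N) = J i
  inter : ∀ i j, ¬ i ≡ j [MOD N] → (J i ∩ J j).Subsingleton
  covering : ∀ u v, u < v → Ioo u v ⊆ Icc 0 2 → ∃ k i, J i ⊆ f^[k] '' Ioo u v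

/-! ### Expansion and covering of intervals by the tent map -/

theorem sub_le_two_of_Ioo_subset {u v : ℝ} (h : Ioo u v ⊆ Icc 0 2) : v - u ≤ 2 := by
  rcases le_or_gt v u with h1 | h1
  · linarith
  · have := closure_minimal h isClosed_Icc
    rw [closure_Ioo h1.ne] at this
    linarith [(this (left_mem_Icc.2 h1.le)).1, (this (right_mem_Icc.2 h1.le)).2]

/-- If every interval either has a good iterate or has an iterate that contains an interval longer
by a factor `ρ > 1`, then every interval has a good iterate. -/
theorem exists_iterate_of_expansion {f : ℝ → ℝ} (hf : MapsTo f (Icc 0 2) (Icc 0 2))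
    {Q : Set ℝ → Prop} (hQ : ∀ s t, Q s → s ⊆ t → Q t) {ρ : ℝ} (hρ : 1 < ρ)
    (step : ∀ u v, u < v → Ioo u v ⊆ Icc 0 2 → (∃ k, Q (f^[k] '' Ioo u v)) ∨
      ∃ k u' v', ρ * (v - u) ≤ v' - u' ∧ Ioo u' v' ⊆ f^[k] '' Ioo u v)
    {u v : ℝ} (huv : u < v) (hI : Ioo u v ⊆ Icc 0 2) : ∃ k, Q (f^[k] '' Ioo u v) := by
  by_contra! H
  -- Without a good iterate the expansion could be repeated forever, producing intervals longer than
  -- `2` inside `[0, 2]`.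
  have grow : ∀ m : ℕ, ∃ k u' v', ρ ^ m * (v - u) ≤ v' - u' ∧ Ioo u' v' ⊆ f^[k] '' Ioo u v := by
    intro m
    induction m with
    | zero => exact ⟨0, u, v, by simp, by simp⟩
    | succ m ih =>
      obtain ⟨k, a, b, hab, hsub⟩ := ih
      have hlt : a < b := by
        have : 0 < ρ ^ m * (v - u) := mul_pos (by positivity) (by linarith)
        linarith
      have h2 : Ioo a b ⊆ Icc 0 2 :=
        hsub.trans (((hf.iterate k).mono_left hI).image_subset)
      have himage : ∀ j, f^[j] '' Ioo a b ⊆ f^[j + k] '' Ioo u v := by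
        intro j
        rw [Function.iterate_add, image_comp]
        exact image_mono hsub
      rcases step a b hlt h2 with ⟨j, hj⟩ | ⟨j, a', b', h3, h4⟩
      · exact absurd (hQ _ _ hj (himage j)) (H _)
      · refine ⟨j + k, a', b', ?_, h4.trans (himage j)⟩
        rw [pow_succ']
        nlinarith
  obtain ⟨m, hm⟩ := pow_unbounded_of_one_lt (2 / (v - u)) hρ
  obtain ⟨k, a, b, hab, hsub⟩ := grow m
  have := sub_le_two_of_Ioo_subset (hsub.trans (((hf.iterate k).mono_left hI).image_subset))
  rw [div_lt_iff₀ (by linarith)] at hm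
  linarith

theorem Ioo_subset_tent_image_left {μ : ℝ} (hμ : 0 < μ) {u v : ℝ} (hv : v ≤ 1) :
    Ioo (μ * u) (μ * v) ⊆ tent μ '' Ioo u v := by
  intro y hy
  have h : y / μ ∈ Ioo u v := by
    rw [mem_Ioo, lt_div_iff₀ hμ, div_lt_iff₀ hμ]
    constructor <;> linarith [hy.1, hy.2]
  refine ⟨y / μ, h, ?_⟩
  rw [tent_of_le (by linarith [h.2]), mul_div_cancel₀ _ hμ.ne']

theorem tent_two_sub (μ x : ℝ) : tent μ (2 - x) = tent μ x := by
  rw [tent_eq, tent_eq, show 2 - x - 1 = -(x - 1) by ring, abs_neg]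

theorem tent_image_Ioo_two_sub (μ u v : ℝ) :
    tent μ '' Ioo (2 - v) (2 - u) = tent μ '' Ioo u v := by
  rw [← Set.image_const_sub_Ioo, image_image]
  simp only [tent_two_sub]

theorem Ioo_subset_tent_image_right {μ : ℝ} (hμ : 0 < μ) {u v : ℝ} (hu : 1 ≤ u) :
    Ioo (μ * (2 - v)) (μ * (2 - u)) ⊆ tent μ '' Ioo u v := by
  rw [← tent_image_Ioo_two_sub]
  exact Ioo_subset_tent_image_left hμ (by linarith)

/-- An interval without turning point is expanded by the factor `μ`. -/
theorem exists_Ioo_subset_tent_image {μ : ℝ} (hμ : 0 < μ) {u v : ℝ} (h : (1 : ℝ) ∉ Ioo u v) :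
    ∃ u' v', μ * (v - u) = v' - u' ∧ Ioo u' v' ⊆ tent μ '' Ioo u v := by
  rcases le_or_gt v 1 with hv | hv
  · exact ⟨_, _, by ring, Ioo_subset_tent_image_left hμ hv⟩
  · have hu : 1 ≤ u := not_lt.1 fun hu => h ⟨hu, hv⟩
    exact ⟨_, _, by ring, Ioo_subset_tent_image_right hμ hu⟩

/-- Some iterate of a given interval contains a neighbourhood of the turning point. -/
theorem exists_turning_point_mem_iterate {μ : ℝ} (hμ : 1 < μ) (hμ2 : μ ≤ 2) {u v : ℝ}
    (huv : u < v) (hI : Ioo u v ⊆ Icc 0 2) :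
    ∃ k a b, a < 1 ∧ 1 < b ∧ Ioo a b ⊆ (tent μ)^[k] '' Ioo u v := by
  refine exists_iterate_of_expansion (mapsTo_tent (by linarith) hμ2)
    (Q := fun s => ∃ a b : ℝ, a < 1 ∧ 1 < b ∧ Ioo a b ⊆ s) ?_ hμ ?_ huv hI
  · rintro s t ⟨a, b, ha, hb, h⟩ hst
    exact ⟨a, b, ha, hb, h.trans hst⟩
  · intro a b hab _
    by_cases h : (1 : ℝ) ∈ Ioo a b
    · exact Or.inl ⟨0, a, b, h.1, h.2, by simp⟩
    · obtain ⟨a', b', h1, h2⟩ := exists_Ioo_subset_tent_image (by linarith : 0 < μ) h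
      exact Or.inr ⟨1, a', b', h1.le, by simpa using h2⟩

theorem tent_image_Icc_one {μ : ℝ} (hμ : 0 < μ) {b : ℝ} :
    tent μ '' Icc 1 b = Icc (μ * (2 - b)) μ := by
  ext y
  constructor
  · rintro ⟨x, hx, rfl⟩
    rw [tent_of_ge hx.1]
    constructor <;> nlinarith [hx.1, hx.2]
  · intro hy
    have h : 2 - y / μ ∈ Icc 1 b := by
      have h1 : 2 - b ≤ y / μ := by rw [le_div_iff₀ hμ]; linarith [hy.1]
      have h2 : y / μ ≤ 1 := by rw [div_le_one hμ]; exact hy.2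
      constructor <;> linarith
    refine ⟨_, h, ?_⟩
    rw [tent_of_ge h.1, sub_sub_cancel, mul_div_cancel₀ _ hμ.ne']

/-- Beyond `√2` the tent map is locally eventually onto its core. -/
theorem exists_core_subset_iterate {μ : ℝ} (hμ : 1 < μ) (hμ2 : μ ≤ 2) (hs : 2 < μ ^ 2) {u v : ℝ}
    (huv : u < v) (hI : Ioo u v ⊆ Icc 0 2) :
    ∃ k, Icc (μ * (2 - μ)) μ ⊆ (tent μ)^[k] '' Ioo u v := by
  have hμ0 : 0 < μ := by linarith
  refine exists_iterate_of_expansion (mapsTo_tent hμ0.le hμ2)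
    (Q := fun s => Icc (μ * (2 - μ)) μ ⊆ s) (fun s t h hst => h.trans hst)
    (by linarith : 1 < μ ^ 2 / 2) ?_ huv hI
  intro a b hab _
  by_cases h : (1 : ℝ) ∈ Ioo a b
  · obtain ⟨c, hc1, hcab, hc⟩ : ∃ c < 1, b - a ≤ 2 * (1 - c) ∧ tent μ '' Ioc c 1 ⊆
        tent μ '' Ioo a b := by
      rcases le_total (b - 1) (1 - a) with h1 | h1
      · exact ⟨a, h.1, by linarith, image_mono fun x hx => ⟨hx.1, hx.2.trans_lt h.2⟩⟩
      · refine ⟨2 - b, by linarith [h.2], by linarith, ?_⟩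
        rw [← tent_image_Ioo_two_sub]
        exact image_mono fun x hx => ⟨hx.1, hx.2.trans_lt (by linarith [h.1])⟩
    have hcov : Ioc (μ * c) μ ⊆ tent μ '' Ioo a b := by
      refine Subset.trans (fun y hy => ?_) hc
      have h : y / μ ∈ Ioc c 1 := by
        rw [mem_Ioc, lt_div_iff₀ hμ0, div_le_one hμ0]
        exact ⟨by linarith [hy.1], hy.2⟩
      exact ⟨y / μ, h, by rw [tent_of_le h.2, mul_div_cancel₀ _ hμ0.ne']⟩
    have hcov2 : ∀ s ⊆ Ioc (μ * c) μ, tent μ '' s ⊆ (tent μ)^[2] '' Ioo a b := by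
      intro s hs
      change _ ⊆ (tent μ ∘ tent μ) '' _
      rw [image_comp]
      exact image_mono (hs.trans hcov)
    -- If the image `(μc, μ]` contains `[1, μ]`, one more step gives the core. Otherwise it lies on
    -- the decreasing branch, and two steps have stretched the half by `μ²`, hence the whole
    -- interval by at least `μ² / 2`.
    rcases lt_or_ge (μ * c) 1 with h1 | h1
    · refine Or.inl ⟨2, ?_⟩
      have := hcov2 (Icc 1 μ) fun x hx => ⟨h1.trans_le hx.1, hx.2⟩
      rwa [tent_image_Icc_one hμ0] at this
    · refine Or.inr ⟨2, _, _, ?_, (Ioo_subset_tent_image_right hμ0 h1).trans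
        (hcov2 (Ioo (μ * c) μ) Ioo_subset_Ioc_self)⟩
      nlinarith [pow_pos hμ0 2]
  · obtain ⟨a', b', h1, h2⟩ := exists_Ioo_subset_tent_image hμ0 h
    exact Or.inr ⟨1, a', b', h1 ▸ mul_le_mul_of_nonneg_right (by nlinarith) (by linarith),
      by simpa using h2⟩

theorem tent_image_core {μ : ℝ} (hμ : 1 < μ) (hμ2 : μ ≤ 2) :
    tent μ '' Icc (μ * (2 - μ)) μ = Icc (μ * (2 - μ)) μ := by
  have hμ0 : 0 < μ := by linarith
  apply Subset.antisymm
  · rintro _ ⟨x, hx, rfl⟩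
    rcases le_total x 1 with h | h
    · rw [tent_of_le h]
      have h1 : 0 ≤ x := le_trans (mul_nonneg hμ0.le (by linarith)) hx.1
      exact ⟨hx.1.trans (by nlinarith), by nlinarith⟩
    · rw [← tent_image_Icc_one hμ0]
      exact mem_image_of_mem _ ⟨h, hx.2⟩
  · conv_lhs => rw [← tent_image_Icc_one hμ0]
    exact image_mono (Icc_subset_Icc_left (by nlinarith [sq_nonneg (μ - 1)]))

theorem isIntervalCycle_core {μ : ℝ} (hμ : 1 < μ) (hμ2 : μ ≤ 2) (hs : 2 < μ ^ 2) :
    IsIntervalCycle (tent μ) 1 fun _ => Icc (μ * (2 - μ)) μ where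
  pos := one_pos
  isCompact _ := isCompact_Icc
  isPreconnected _ := isPreconnected_Icc
  nontrivial _ := by
    have h : μ * (2 - μ) < μ := by nlinarith
    exact ⟨_, left_mem_Icc.2 h.le, _, right_mem_Icc.2 h.le, h.ne⟩
  subset _ := Icc_subset_Icc (mul_nonneg (by linarith) (by linarith)) hμ2
  image _ := tent_image_core hμ hμ2
  periodic _ := rfl
  inter _ _ h := absurd (Nat.modEq_one) h
  covering u v huv hI := by
    obtain ⟨k, hk⟩ := exists_core_subset_iterate hμ hμ2 hs huv hI
    exact ⟨k, 0, hk⟩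

/-- With `1 + r` the fixed point of the tent map, the square of the map on `[1 - r, 1 + r]` is
conjugate to the tent map of slope `μ²` by the orientation-reversing `h`. The even intervals of the
new cycle are the `h`-images of the old ones; the odd ones are their images, beyond the fixed point.
-/
theorem exists_isIntervalCycle_renormalization {μ : ℝ} (hμ : 1 < μ) (hμ2 : μ ^ 2 ≤ 2) {N : ℕ}
    {J' : ℕ → Set ℝ} (hJ : IsIntervalCycle (tent (μ ^ 2)) N J') :
    ∃ J, IsIntervalCycle (tent μ) (2 * N) J := by
  have hμ0 : 0 < μ := by linarith
  have hμle : μ ≤ 2 := by nlinarith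
  obtain ⟨r, hr⟩ : ∃ r, r = (μ - 1) / (μ + 1) := ⟨_, rfl⟩
  have hrμ : r * (μ + 1) = μ - 1 := by rw [hr, div_mul_cancel₀ _ (by linarith)]
  have hr0 : 0 < r := by rw [hr]; exact div_pos (by linarith) (by linarith)
  have hr1 : r < 1 := by nlinarith
  have hfix : μ * (1 - r) = 1 + r := by linarith
  set f := tent μ with hf
  set g := tent (μ ^ 2) with hg
  set h : ℝ → ℝ := fun x => 1 + r - r * x with hh
  have hhc : Continuous h := by fun_prop
  have hinj : Function.Injective h := fun x y hxy => by
    have : r * x = r * y := by simp only [h] at hxy; linarith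
    exact mul_left_cancel₀ hr0.ne' this
  have hfc : Continuous f := continuous_tent μ
  have hgm : MapsTo g (Icc 0 2) (Icc 0 2) := mapsTo_tent (by positivity) hμ2
  have hfh : ∀ x, f (h x) = μ * (1 - r * |x - 1|) := by
    intro x
    rw [hf, tent_eq, show h x - 1 = -(r * (x - 1)) by simp only [h]; ring, abs_neg, abs_mul,
      abs_of_pos hr0]
  have hfh_ge : ∀ x ∈ Icc (0 : ℝ) 2, 1 + r ≤ f (h x) := by
    intro x hx
    have : |x - 1| ≤ 1 := abs_le.2 ⟨by linarith [hx.1], by linarith [hx.2]⟩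
    rw [hfh, ← hfix]
    exact mul_le_mul_of_nonneg_left (by nlinarith) hμ0.le
  have hconj : ∀ x ∈ Icc (0 : ℝ) 2, f (f (h x)) = h (g x) := by
    intro x hx
    rw [hf, tent_of_ge (by linarith [hfh_ge x hx]), ← hf, hfh, hg, tent_eq]
    simp only [h]
    linear_combination (μ - 1) * hrμ
  have hconjk : ∀ k, ∀ x ∈ Icc (0 : ℝ) 2, f^[2 * k] (h x) = h (g^[k] x) := by
    intro k
    induction k with
    | zero => intro x _; rfl
    | succ k ih =>
      intro x hx
      rw [Nat.mul_succ, Function.iterate_add_apply, Function.iterate_succ_apply g]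
      exact (congrArg f^[2 * k] (hconj x hx)).trans (ih _ (hgm hx))
  have hJ' : ∀ i, g^[i] '' J' 0 = J' i := by
    intro i
    induction i with
    | zero => simp
    | succ i ih => rw [Function.iterate_succ', image_comp, ih, hJ.image]
  obtain ⟨J, hJdef⟩ : ∃ J : ℕ → Set ℝ, J = fun i => f^[i] '' (h '' J' 0) := ⟨_, rfl⟩
  have hsucc : ∀ i, f '' J i = J (i + 1) := by
    intro i
    simp only [hJdef]
    rw [Function.iterate_succ', image_comp]
  have heven : ∀ i, J (2 * i) = h '' J' i := by
    intro i
    rw [← hJ', image_image, hJdef]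
    simp only [image_image]
    exact image_congr fun x hx => hconjk i x (hJ.subset 0 hx)
  have heven_le : ∀ i, ∀ y ∈ J (2 * i), y ≤ 1 + r := by
    intro i y hy
    rw [heven] at hy
    obtain ⟨x, hx, rfl⟩ := hy
    have := (hJ.subset i hx).1
    simp only [h]
    nlinarith
  have hodd_ge : ∀ i, ∀ y ∈ J (2 * i + 1), 1 + r ≤ y := by
    intro i y hy
    rw [← hsucc, heven] at hy
    obtain ⟨_, ⟨x, hx, rfl⟩, rfl⟩ := hy
    exact hfh_ge x (hJ.subset i hx)
  have heven_nontrivial : ∀ i, (J (2 * i)).Nontrivial := fun i => by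
    rw [heven]
    exact (hJ.nontrivial i).image hinj
  have heven_inter : ∀ a b, ¬ a ≡ b [MOD N] → (J (2 * a) ∩ J (2 * b)).Subsingleton := by
    intro a b hab
    rw [heven, heven, ← image_inter hinj]
    exact (hJ.inter a b hab).image h
  have heven_odd : ∀ a b, (J (2 * a) ∩ J (2 * b + 1)).Subsingleton := by
    intro a b x hx y hy
    rw [le_antisymm (heven_le a x hx.1) (hodd_ge b x hx.2),
      le_antisymm (heven_le a y hy.1) (hodd_ge b y hy.2)]
  refine ⟨J, Nat.mul_pos two_pos hJ.pos, ?_, ?_, ?_, ?_, hsucc, ?_, ?_, ?_⟩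
  · intro i
    rw [hJdef]
    exact ((hJ.isCompact 0).image hhc).image (hfc.iterate i)
  · intro i
    rw [hJdef]
    exact ((hJ.isPreconnected 0).image h hhc.continuousOn).image _ (hfc.iterate i).continuousOn
  · intro i
    obtain ⟨a, rfl | rfl⟩ := Nat.even_or_odd' i
    · exact heven_nontrivial a
    · refine nontrivial_of_image f _ ?_
      rw [hsucc]
      exact heven_nontrivial (a + 1)
  · intro i
    rw [hJdef]
    refine MapsTo.image_subset (((mapsTo_tent hμ0.le hμle).iterate i).mono_left ?_)
    rintro _ ⟨x, hx, rfl⟩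
    obtain ⟨h0, h2⟩ := hJ.subset 0 hx
    simp only [h]
    constructor <;> nlinarith
  · intro i
    have : J (2 * N) = J (2 * 0) := by
      have h0 := hJ.periodic 0
      rw [Nat.zero_add] at h0
      rw [heven, heven, h0]
    induction i with
    | zero => simpa using this
    | succ i ih => rw [Nat.add_right_comm, ← hsucc, ih, hsucc]
  · intro i j hij
    obtain ⟨a, rfl | rfl⟩ := Nat.even_or_odd' i <;> obtain ⟨b, rfl | rfl⟩ := Nat.even_or_odd' j
    · exact heven_inter a b fun hab => hij (hab.mul_left' 2)
    · exact heven_odd a b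
    · rw [inter_comm]
      exact heven_odd b a
    -- Two odd intervals lie on the decreasing branch, where the map is injective, and it carries
    -- them to even intervals with distinct indices.
    · intro x hx y hy
      have hab : ¬ a + 1 ≡ b + 1 [MOD N] := fun hab =>
        hij ((Nat.ModEq.add_right_cancel' 1 hab).mul_left' 2 |>.add_right 1)
      have hmem : ∀ z ∈ J (2 * a + 1) ∩ J (2 * b + 1), f z ∈ J (2 * (a + 1)) ∩ J (2 * (b + 1)) :=
        fun z hz => ⟨(hsucc (2 * a + 1)).subset (mem_image_of_mem f hz.1),
          (hsucc (2 * b + 1)).subset (mem_image_of_mem f hz.2)⟩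
      have h1 := heven_inter _ _ hab (hmem x hx) (hmem y hy)
      rw [hf, tent_of_ge (by linarith [hodd_ge a x hx.1]),
        tent_of_ge (by linarith [hodd_ge a y hy.1])] at h1
      have h2 := mul_left_cancel₀ hμ0.ne' h1
      linarith
  · intro u v huv hI
    obtain ⟨k, a, b, ha, hb, hab⟩ := exists_turning_point_mem_iterate hμ hμle huv hI
    -- `t` is small enough that `h` maps `(1 - t, 1 + t)` into the neighbourhood `(a, b)` of the
    -- turning point; the covering property of the old cycle then applies to this interval.
    obtain ⟨t, ht0, ht1, hta, htb⟩ : ∃ t, 0 < t ∧ t ≤ 1 ∧ a ≤ 1 - r * t ∧ 1 + r * t ≤ b := by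
      refine ⟨min 1 (min ((1 - a) / r) ((b - 1) / r)), ?_, min_le_left _ _, ?_, ?_⟩
      · exact lt_min one_pos (lt_min (div_pos (by linarith) hr0) (div_pos (by linarith) hr0))
      · have := (min_le_right 1 (min ((1 - a) / r) ((b - 1) / r))).trans (min_le_left _ _)
        rw [le_div_iff₀ hr0] at this
        linarith
      · have := (min_le_right 1 (min ((1 - a) / r) ((b - 1) / r))).trans (min_le_right _ _)
        rw [le_div_iff₀ hr0] at this
        linarith
    have hsub : Ioo (1 - t) (1 + t) ⊆ Icc 0 2 := fun x hx =>
      ⟨by linarith [hx.1], by linarith [hx.2]⟩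
    obtain ⟨m, i, hm⟩ := hJ.covering (1 - t) (1 + t) (by linarith) hsub
    refine ⟨2 * m + k, 2 * i, ?_⟩
    rw [heven, Function.iterate_add, image_comp]
    rintro _ ⟨x, hx, rfl⟩
    obtain ⟨y, hy, rfl⟩ := hm hx
    rw [← hconjk m y (hsub hy)]
    refine mem_image_of_mem _ (hab ⟨?_, ?_⟩) <;> simp only [h]
    · nlinarith [hy.1, hy.2]
    · nlinarith [hy.1, hy.2]

theorem exists_isIntervalCycle (n : ℕ) {μ : ℝ} (hμ : 1 < μ) (hn : μ ^ 2 ^ n ≤ 2)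
    (hn' : 2 < μ ^ 2 ^ (n + 1)) : ∃ J, IsIntervalCycle (tent μ) (2 ^ n) J := by
  induction n generalizing μ with
  | zero => exact ⟨_, isIntervalCycle_core hμ (by simpa using hn) (by simpa using hn')⟩
  | succ n ih =>
    have h2 := (sq_le_of_pow_two_pow_le hμ n).trans hn
    have hpow : ∀ k, (μ ^ 2) ^ 2 ^ k = μ ^ 2 ^ (k + 1) := fun k => by
      rw [← pow_mul, pow_succ' 2 k]
    obtain ⟨J', hJ'⟩ := ih (μ := μ ^ 2) (by nlinarith) (by rwa [hpow]) (by rwa [hpow])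
    rw [pow_succ']
    exact exists_isIntervalCycle_renormalization hμ h2 hJ'

/-! ### Products of intervals in the plane -/

/-- The product set `s × t` in the plane. -/
def box (s t : Set ℝ) : Set Plane := {p | p 0 ∈ s ∧ p 1 ∈ t}

theorem box_mono {s t s' t' : Set ℝ} (h : s ⊆ s') (h' : t ⊆ t') : box s t ⊆ box s' t' :=
  fun _ hp => ⟨h hp.1, h' hp.2⟩

theorem mk_mem_box {s t : Set ℝ} {x y : ℝ} (hx : x ∈ s) (hy : y ∈ t) :
    (!₂[x, y] : Plane) ∈ box s t := ⟨by simpa using hx, by simpa using hy⟩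

theorem isCompact_box {s t : Set ℝ} (hs : IsCompact s) (ht : IsCompact t) :
    IsCompact (box s t) := by
  have : box s t = (EuclideanSpace.equiv (Fin 2) ℝ) ⁻¹' (Set.univ.pi ![s, t]) := by
    ext p
    rw [mem_preimage, Set.mem_univ_pi, Fin.forall_fin_two]
    rfl
  rw [this]
  refine (EuclideanSpace.equiv (Fin 2) ℝ).toHomeomorph.isCompact_preimage.2
    (isCompact_univ_pi fun i => ?_)
  fin_cases i
  · exact hs
  · exact ht

theorem exists_Ioo_subset_of_mem {s : Set ℝ} (hs : IsPreconnected s) (hs' : s.Nontrivial) {x : ℝ}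
    (hx : x ∈ s) {ε : ℝ} (hε : 0 < ε) :
    ∃ u v, u < v ∧ Ioo u v ⊆ s ∧ Ioo u v ⊆ Metric.ball x ε := by
  obtain ⟨y, hy, hyx⟩ := hs'.exists_ne x
  rcases hyx.lt_or_gt with h | h
  · refine ⟨max y (x - ε), x, max_lt h (by linarith), fun z hz => ?_, fun z hz => ?_⟩
    · exact hs.ordConnected.out hy hx ⟨(le_max_left _ _).trans hz.1.le, hz.2.le⟩
    · rw [Real.ball_eq_Ioo]
      exact ⟨(le_max_right _ _).trans_lt hz.1, by linarith [hz.2]⟩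
  · refine ⟨x, min y (x + ε), lt_min h (by linarith), fun z hz => ?_, fun z hz => ?_⟩
    · exact hs.ordConnected.out hx hy ⟨hz.1.le, hz.2.le.trans (min_le_left _ _)⟩
    · rw [Real.ball_eq_Ioo]
      exact ⟨by linarith [hz.1], hz.2.trans_le (min_le_right _ _)⟩

/-- The given point may be on the boundary of `s × t`, so one-sided intervals next to it are used.
-/
theorem exists_box_subset {U : Set Plane} (hU : IsOpen U) {s t : Set ℝ} (hs : IsPreconnected s)
    (hs' : s.Nontrivial) (ht : IsPreconnected t) (ht' : t.Nontrivial)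
    (h : (U ∩ box s t).Nonempty) :
    ∃ u v u' v', u < v ∧ u' < v' ∧ Ioo u v ⊆ s ∧ Ioo u' v' ⊆ t ∧
      box (Ioo u v) (Ioo u' v') ⊆ U := by
  obtain ⟨p, hpU, hps, hpt⟩ := h
  have hV : IsOpen ((EuclideanSpace.equiv (Fin 2) ℝ).symm ⁻¹' U) :=
    hU.preimage (EuclideanSpace.equiv (Fin 2) ℝ).symm.continuous
  obtain ⟨ε, hε, hball⟩ := Metric.isOpen_iff.1 hV (EuclideanSpace.equiv (Fin 2) ℝ p) hpU
  obtain ⟨u, v, huv, hs1, hs2⟩ := exists_Ioo_subset_of_mem hs hs' hps hε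
  obtain ⟨u', v', huv', ht1, ht2⟩ := exists_Ioo_subset_of_mem ht ht' hpt hε
  refine ⟨u, v, u', v', huv, huv', hs1, ht1, fun q hq => ?_⟩
  refine hball (a := EuclideanSpace.equiv (Fin 2) ℝ q) ?_
  rw [Metric.mem_ball, dist_pi_lt_iff hε, Fin.forall_fin_two]
  exact ⟨hs2 hq.1, ht2 hq.2⟩

theorem continuous_tentProduct (μ : ℝ) : Continuous (tentProduct μ) := by
  have h := continuous_tent μ
  unfold tentProduct
  fun_prop

theorem tentProduct_iterate_apply (μ : ℝ) (k : ℕ) (p : Plane) (i : Fin 2) :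
    (tentProduct μ)^[k] p i = (tent μ)^[k] (p i) := by
  induction k generalizing p with
  | zero => rfl
  | succ k ih =>
    rw [Function.iterate_succ_apply, Function.iterate_succ_apply, ih, tentProduct_apply]

theorem tentProduct_iterate_image_box (μ : ℝ) (k : ℕ) (s t : Set ℝ) :
    (tentProduct μ)^[k] '' box s t = box ((tent μ)^[k] '' s) ((tent μ)^[k] '' t) := by
  ext q
  constructor
  · rintro ⟨p, hp, rfl⟩
    rw [box, mem_ofPred_eq, tentProduct_iterate_apply, tentProduct_iterate_apply]
    exact ⟨mem_image_of_mem _ hp.1, mem_image_of_mem _ hp.2⟩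
  · rintro ⟨⟨x, hx, hx'⟩, y, hy, hy'⟩
    refine ⟨!₂[x, y], mk_mem_box hx hy, ?_⟩
    ext i
    rw [tentProduct_iterate_apply]
    fin_cases i
    · exact hx'
    · exact hy'

/-! ### The attractors -/

/-- The union of the products `J i × J (i + d)`. -/
def diagonal (J : ℕ → Set ℝ) (d : ℕ) : Set Plane := ⋃ i, box (J i) (J (i + d))

theorem box_subset_diagonal (J : ℕ → Set ℝ) (i d : ℕ) : box (J i) (J (i + d)) ⊆ diagonal J d :=
  subset_iUnion (fun i => box (J i) (J (i + d))) i

/-- Steers a cyclic index to a prescribed residue at an arbitrarily late time. -/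
theorem exists_add_modEq {N : ℕ} (hN : 0 < N) (i a m : ℕ) : ∃ k, m ≤ k ∧ i + k ≡ a [MOD N] := by
  obtain ⟨M, rfl⟩ : ∃ M, N = M + 1 := ⟨N - 1, by omega⟩
  refine ⟨a + i * M + m * (M + 1), by nlinarith, ?_⟩
  rw [show i + (a + i * M + m * (M + 1)) = a + (M + 1) * (i + m) by ring]
  simp [Nat.ModEq]

namespace IsIntervalCycle

variable {μ : ℝ} {N : ℕ} {J : ℕ → Set ℝ}

theorem congr {f : ℝ → ℝ} (hJ : IsIntervalCycle f N J) {i j : ℕ} (h : i ≡ j [MOD N]) :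
    J i = J j := by
  have hp : Function.Periodic J N := hJ.periodic
  rw [← hp.map_mod_nat i, ← hp.map_mod_nat j, h]

theorem modEq_of_subset {f : ℝ → ℝ} (hJ : IsIntervalCycle f N J) {i j : ℕ} (h : J i ⊆ J j) :
    i ≡ j [MOD N] := by
  by_contra hij
  have := hJ.inter i j hij
  rw [inter_eq_left.2 h] at this
  exact this.not_nontrivial (hJ.nontrivial i)

theorem iterate_image {f : ℝ → ℝ} (hJ : IsIntervalCycle f N J) (k i : ℕ) :
    f^[k] '' J i = J (i + k) := by
  induction k generalizing i with
  | zero => simp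
  | succ k ih =>
    rw [Function.iterate_succ, image_comp, hJ.image, ih, Nat.add_assoc, Nat.add_comm 1]

/-- Once one interval of the cycle is covered, the later iterates cover its successors. The index is
shifted so that `i + k` is the one covered at time `k`. -/
theorem exists_covering {f : ℝ → ℝ} (hJ : IsIntervalCycle f N J) {u v : ℝ} (huv : u < v)
    (h : Ioo u v ⊆ Icc 0 2) : ∃ k₀ i, ∀ k ≥ k₀, J (i + k) ⊆ f^[k] '' Ioo u v := by
  obtain ⟨k₀, i, h⟩ := hJ.covering u v huv h
  obtain ⟨j, -, hj⟩ := exists_add_modEq hJ.pos k₀ i 0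
  refine ⟨k₀, j, fun k hk => ?_⟩
  obtain ⟨l, rfl⟩ := Nat.exists_eq_add_of_le hk
  rw [Nat.add_comm k₀ l, Function.iterate_add, image_comp, Nat.add_comm l, ← Nat.add_assoc,
    Nat.add_comm j, ← hJ.iterate_image, hJ.congr hj]
  exact image_mono h

theorem exists_box_covering (hJ : IsIntervalCycle (tent μ) N J) {u v u' v' : ℝ} (huv : u < v)
    (huv' : u' < v') (h : Ioo u v ⊆ Icc 0 2) (h' : Ioo u' v' ⊆ Icc 0 2) :
    ∃ k₀ i j, ∀ k ≥ k₀, box (J (i + k)) (J (j + k)) ⊆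
      (tentProduct μ)^[k] '' box (Ioo u v) (Ioo u' v') := by
  obtain ⟨k₁, i, h1⟩ := hJ.exists_covering huv h
  obtain ⟨k₂, j, h2⟩ := hJ.exists_covering huv' h'
  refine ⟨max k₁ k₂, i, j, fun k hk => ?_⟩
  rw [tentProduct_iterate_image_box]
  exact fun p hp => ⟨h1 k (le_of_max_le_left hk) hp.1, h2 k (le_of_max_le_right hk) hp.2⟩

/-- The iterates of a relatively open subset of `[0, 2] × [0, 2]` eventually contain products of
intervals of the cycle. -/
theorem exists_covering_of_isOpen (hJ : IsIntervalCycle (tent μ) N J) {U : Set Plane}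
    (hU : IsOpen U) (h : (U ∩ square).Nonempty) :
    ∃ k₀ i j, ∀ k ≥ k₀, box (J (i + k)) (J (j + k)) ⊆ (tentProduct μ)^[k] '' (U ∩ square) := by
  have hnt : (Icc (0 : ℝ) 2).Nontrivial := ⟨0, by simp, 2, by simp, by norm_num⟩
  obtain ⟨u, v, u', v', huv, huv', h1, h1', h2⟩ :=
    exists_box_subset hU isPreconnected_Icc hnt isPreconnected_Icc hnt h
  obtain ⟨k₀, i, j, hk⟩ := hJ.exists_box_covering huv huv' h1 h1'
  exact ⟨k₀, i, j, fun k h => (hk k h).trans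
    (image_mono (subset_inter h2 (box_mono h1 h1')))⟩

/-- The iterates of a relatively open subset of `diagonal J d` eventually contain the components
of `diagonal J d` one after the other. -/
theorem exists_covering_diagonal (hJ : IsIntervalCycle (tent μ) N J) {d : ℕ} {U : Set Plane}
    (hU : IsOpen U) (h : (U ∩ diagonal J d).Nonempty) :
    ∃ k₀ i, ∀ k ≥ k₀, box (J (i + k)) (J (i + k + d)) ⊆
      (tentProduct μ)^[k] '' (U ∩ diagonal J d) := by
  obtain ⟨p, hpU, hp⟩ := h
  obtain ⟨a, ha⟩ := mem_iUnion.1 hp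
  obtain ⟨u, v, u', v', huv, huv', h1, h1', h2⟩ := exists_box_subset hU (hJ.isPreconnected a)
    (hJ.nontrivial a) (hJ.isPreconnected (a + d)) (hJ.nontrivial (a + d)) ⟨p, hpU, ha⟩
  obtain ⟨k₀, i, j, hk⟩ := hJ.exists_box_covering huv huv' (h1.trans (hJ.subset a))
    (h1'.trans (hJ.subset (a + d)))
  refine ⟨k₀, a, fun k hk₀ => ?_⟩
  have h3 := hk k hk₀
  -- The small box stays in the moving component `J (a + k) × J (a + d + k)`; the product it covers
  -- lies in that component, hence equals it.
  have h4 : (tentProduct μ)^[k] '' box (Ioo u v) (Ioo u' v') ⊆ box (J (a + k)) (J (a + d + k)) := by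
    rw [tentProduct_iterate_image_box, ← hJ.iterate_image, ← hJ.iterate_image]
    exact box_mono (image_mono h1) (image_mono h1')
  have h5 := h3.trans h4
  obtain ⟨x, hx⟩ := (hJ.nontrivial (i + k)).nonempty
  obtain ⟨y, hy⟩ := (hJ.nontrivial (j + k)).nonempty
  have e1 : J (i + k) = J (a + k) :=
    hJ.congr (hJ.modEq_of_subset fun x hx => (h5 (mk_mem_box hx hy)).1)
  have e2 : J (j + k) = J (a + d + k) :=
    hJ.congr (hJ.modEq_of_subset fun y hy => (h5 (mk_mem_box hx hy)).2)
  rw [e1, e2] at h3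
  rw [Nat.add_right_comm a k d]
  exact h3.trans (image_mono (subset_inter h2
    ((box_mono h1 h1').trans (box_subset_diagonal J a d))))

theorem diagonal_subset_square (hJ : IsIntervalCycle (tent μ) N J) (d : ℕ) :
    diagonal J d ⊆ square :=
  iUnion_subset fun i _ hp => ⟨hJ.subset i hp.1, hJ.subset (i + d) hp.2⟩

theorem diagonal_nonempty (hJ : IsIntervalCycle (tent μ) N J) (d : ℕ) :
    (diagonal J d).Nonempty := by
  obtain ⟨x, hx⟩ := (hJ.nontrivial 0).nonempty
  obtain ⟨y, hy⟩ := (hJ.nontrivial (0 + d)).nonempty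
  exact ⟨_, box_subset_diagonal J 0 d (mk_mem_box hx hy)⟩

theorem isCompact_diagonal (hJ : IsIntervalCycle (tent μ) N J) (d : ℕ) :
    IsCompact (diagonal J d) := by
  have : diagonal J d = ⋃ i ∈ Finset.range N, box (J i) (J (i + d)) := by
    apply Subset.antisymm
    · refine iUnion_subset fun i => ?_
      rw [← hJ.congr (Nat.mod_modEq i N), ← hJ.congr ((Nat.mod_modEq i N).add_right d)]
      exact subset_biUnion_of_mem (u := fun i => box (J i) (J (i + d)))
        (Finset.mem_coe.2 (Finset.mem_range.2 (Nat.mod_lt i hJ.pos)))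
    · exact iUnion₂_subset fun i _ => box_subset_diagonal J i d
  rw [this]
  exact Finset.isCompact_biUnion _ fun i _ => isCompact_box (hJ.isCompact i) (hJ.isCompact (i + d))

theorem image_diagonal (hJ : IsIntervalCycle (tent μ) N J) (d : ℕ) :
    tentProduct μ '' diagonal J d = diagonal J d := by
  have himage : ∀ i, tentProduct μ '' box (J i) (J (i + d)) =
      box (J (i + 1)) (J (i + 1 + d)) := by
    intro i
    have := tentProduct_iterate_image_box μ 1 (J i) (J (i + d))
    simp only [Function.iterate_one] at this
    rw [this, hJ.image, hJ.image, Nat.add_right_comm]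
  rw [diagonal, image_iUnion]
  simp only [himage]
  apply Subset.antisymm
  · exact iUnion_subset fun i => box_subset_diagonal J (i + 1) d
  · refine iUnion_subset fun i => ?_
    obtain ⟨M, hM⟩ : ∃ M, N = M + 1 := ⟨N - 1, by have := hJ.pos; omega⟩
    have h : i + M + 1 ≡ i [MOD N] := by rw [Nat.add_assoc, ← hM]; simp [Nat.ModEq]
    rw [← hJ.congr h, ← hJ.congr (h.add_right d)]
    exact subset_iUnion (fun i => box (J (i + 1)) (J (i + 1 + d))) (i + M)

theorem mapsTo_diagonal (hJ : IsIntervalCycle (tent μ) N J) (d k : ℕ) :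
    MapsTo (tentProduct μ)^[k] (diagonal J d) (diagonal J d) :=
  MapsTo.iterate (fun _ hp => (hJ.image_diagonal d).subset (mem_image_of_mem _ hp)) k

theorem interior_inter_nonempty (hJ : IsIntervalCycle (tent μ) N J) (i j : ℕ) :
    (interior (box (J i) (J j))).Nonempty := by
  obtain ⟨x, hx⟩ := (hJ.nontrivial i).nonempty
  obtain ⟨y, hy⟩ := (hJ.nontrivial j).nonempty
  obtain ⟨u, v, u', v', huv, huv', h1, h1', -⟩ := exists_box_subset isOpen_univ
    (hJ.isPreconnected i) (hJ.nontrivial i) (hJ.isPreconnected j) (hJ.nontrivial j)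
    ⟨_, mem_univ _, mk_mem_box hx hy⟩
  obtain ⟨x, hx⟩ := nonempty_Ioo.2 huv
  obtain ⟨y, hy⟩ := nonempty_Ioo.2 huv'
  exact ⟨_, mem_interior.2 ⟨box (Ioo u v) (Ioo u' v'), box_mono h1 h1',
    isOpen_box u v u' v', mk_mem_box hx hy⟩⟩

theorem interior_diagonal_nonempty (hJ : IsIntervalCycle (tent μ) N J) (d : ℕ) :
    (interior (diagonal J d)).Nonempty :=
  (hJ.interior_inter_nonempty 0 (0 + d)).mono (interior_mono (box_subset_diagonal J 0 d))

/-- Any two relatively open subsets of `diagonal J d` communicate at arbitrarily late times. -/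
theorem exists_iterate_mem_of_isOpen (hJ : IsIntervalCycle (tent μ) N J) {d : ℕ} {U V : Set Plane}
    (hU : IsOpen U) (hUd : (U ∩ diagonal J d).Nonempty) (hVd : (V ∩ diagonal J d).Nonempty)
    (m : ℕ) : ∃ n ≥ m, ∃ p ∈ U ∩ diagonal J d, (tentProduct μ)^[n] p ∈ V ∩ diagonal J d := by
  obtain ⟨q, hqV, hq⟩ := hVd
  obtain ⟨a, ha⟩ := mem_iUnion.1 hq
  obtain ⟨k₀, i, hk⟩ := hJ.exists_covering_diagonal hU hUd
  obtain ⟨k, hkm, hka⟩ := exists_add_modEq hJ.pos i a (max k₀ m)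
  have := hk k (le_of_max_le_left hkm)
  rw [hJ.congr hka, hJ.congr (hka.add_right d)] at this
  obtain ⟨p, hp, rfl⟩ := this ha
  exact ⟨k, le_of_max_le_right hkm, p, hp, hqV, hq⟩

theorem isTransitiveOn_diagonal (hJ : IsIntervalCycle (tent μ) N J) (d : ℕ) :
    IsTransitiveOn (tentProduct μ) (diagonal J d) := by
  intro U V hU _ hUd hVd
  obtain ⟨n, -, p, hp, hpV⟩ := hJ.exists_iterate_mem_of_isOpen hU hUd hVd 0
  exact ⟨n, _, mem_image_of_mem _ hp, hpV⟩

theorem isAttractor_diagonal (hJ : IsIntervalCycle (tent μ) N J) (d : ℕ) :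
    IsAttractor square (tentProduct μ) (diagonal J d) where
  subset := hJ.diagonal_subset_square d
  nonempty := hJ.diagonal_nonempty d
  isCompact := hJ.isCompact_diagonal d
  invariant := hJ.image_diagonal d
  transitive := hJ.isTransitiveOn_diagonal d
  stable := by
    refine ⟨interior (diagonal J d), isOpen_interior, ?_, ?_⟩
    · rw [inter_eq_left.2 (interior_subset.trans (hJ.diagonal_subset_square d))]
      exact hJ.interior_diagonal_nonempty d
    · rintro p ⟨hp, hpM⟩
      refine ⟨hpM, ?_⟩
      simp only [Metric.infDist_zero_of_mem (hJ.mapsTo_diagonal d _ (interior_subset hp))]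
      exact tendsto_const_nhds

/-- Otherwise a coordinate would be constant on all later images of `U ∩ diagonal J d`, although
these cover nondegenerate products. -/
theorem exists_iterate_ne_one (hJ : IsIntervalCycle (tent μ) N J) {d : ℕ} {U : Set Plane}
    (hU : IsOpen U) (hUd : (U ∩ diagonal J d).Nonempty) (n : ℕ) (c : Fin 2) :
    ∃ p ∈ U ∩ diagonal J d, (tentProduct μ)^[n] p c ≠ 1 := by
  by_contra! H
  obtain ⟨k₀, i, hk⟩ := hJ.exists_covering_diagonal hU hUd
  have hcov := hk (k₀ + n) (Nat.le_add_right _ _)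
  have hconst : ∀ q ∈ box (J (i + (k₀ + n))) (J (i + (k₀ + n) + d)), q c = (tent μ)^[k₀] 1 := by
    intro q hq
    obtain ⟨p, hp, rfl⟩ := hcov hq
    rw [Function.iterate_add_apply, tentProduct_iterate_apply, H p hp]
  obtain ⟨x, hx, x', hx', hxx⟩ := hJ.nontrivial (i + (k₀ + n))
  obtain ⟨y, hy, y', hy', hyy⟩ := hJ.nontrivial (i + (k₀ + n) + d)
  have h1 := hconst _ (mk_mem_box hx hy)
  have h2 := hconst _ (mk_mem_box hx' hy')
  rw [← h2] at h1
  fin_cases c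
  · exact hxx h1
  · exact hyy h1

/-- A generic point of `diagonal J d` visits all open sets infinitely often and never meets the
lines on which the map is not differentiable. -/
theorem exists_generic_point (hJ : IsIntervalCycle (tent μ) N J) (d : ℕ) :
    ∃ z ∈ diagonal J d, (∀ V : Set Plane, IsOpen V → (V ∩ diagonal J d).Nonempty →
      ∀ m, ∃ n ≥ m, (tentProduct μ)^[n] z ∈ V) ∧ ∀ n c, (tentProduct μ)^[n] z c ≠ 1 := by
  have : CompactSpace (diagonal J d) := isCompact_iff_compactSpace.1 (hJ.isCompact_diagonal d)
  have : Nonempty (diagonal J d) := (hJ.diagonal_nonempty d).to_subtype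
  have hdense : ∀ s : Set (diagonal J d), (∀ U : Set Plane, IsOpen U →
      (U ∩ diagonal J d).Nonempty → ∃ p : diagonal J d, p.1 ∈ U ∧ p ∈ s) → Dense s := by
    intro s hs
    rw [dense_iff_inter_open]
    rintro _ ⟨U, hU, rfl⟩ ⟨p, hp⟩
    exact hs U hU ⟨p.1, hp, p.2⟩
  have hcont : ∀ n, Continuous fun z : diagonal J d => (tentProduct μ)^[n] z.1 := fun n =>
    ((continuous_tentProduct μ).iterate n).comp continuous_subtype_val
  -- Baire category in the compact space `diagonal J d`: for each basic open set and each `m`, the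
  -- points visiting it after time `m` form a dense open set.
  have hvisit : ∀ᶠ z in residual (diagonal J d), ∀ B ∈ TopologicalSpace.countableBasis Plane,
      ∀ m, (B ∩ diagonal J d).Nonempty → ∃ n ≥ m, (tentProduct μ)^[n] z.1 ∈ B := by
    rw [eventually_countable_ball (TopologicalSpace.countable_countableBasis Plane)]
    intro B hB
    rw [eventually_countable_forall]
    intro m
    by_cases hBd : (B ∩ diagonal J d).Nonempty
    · have hopen := TopologicalSpace.isOpen_of_mem_countableBasis hB
      have hset : {z : diagonal J d | ∃ n ≥ m, (tentProduct μ)^[n] z.1 ∈ B} =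
          ⋃ n ≥ m, (fun z : diagonal J d => (tentProduct μ)^[n] z.1) ⁻¹' B := by
        ext z
        simp
      refine Filter.mem_of_superset (residual_of_dense_open
        (s := {z : diagonal J d | ∃ n ≥ m, (tentProduct μ)^[n] z.1 ∈ B}) ?_ ?_) fun z hz _ => hz
      · rw [hset]
        exact isOpen_biUnion fun n _ => hopen.preimage (hcont n)
      · refine hdense _ fun U hU hUd => ?_
        obtain ⟨n, hn, p, hp, hpV⟩ := hJ.exists_iterate_mem_of_isOpen hU hUd hBd m
        exact ⟨⟨p, hp.2⟩, hp.1, n, hn, hpV.1⟩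
    · exact Eventually.of_forall fun z h => absurd h hBd
  have havoid : ∀ᶠ z in residual (diagonal J d), ∀ n c, (tentProduct μ)^[n] z.1 c ≠ 1 := by
    simp only [eventually_countable_forall]
    intro n c
    refine residual_of_dense_open ?_ (hdense _ fun U hU hUd => ?_)
    · have : Continuous fun z : diagonal J d => (tentProduct μ)^[n] z.1 c :=
        (by fun_prop : Continuous fun p : Plane => p c).comp (hcont n)
      exact isOpen_ne.preimage this
    · obtain ⟨p, hp, hne⟩ := hJ.exists_iterate_ne_one hU hUd n c
      exact ⟨⟨p, hp.2⟩, hp.1, hne⟩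
  obtain ⟨z, hz1, hz2⟩ := (dense_of_mem_residual (hvisit.and havoid)).nonempty
  refine ⟨z.1, z.2, fun V hV hVd m => ?_, hz2⟩
  obtain ⟨q, hqV, hq⟩ := hVd
  obtain ⟨B, hB, hqB, hBV⟩ :=
    (TopologicalSpace.isBasis_countableBasis Plane).exists_subset_of_mem_open hqV hV
  obtain ⟨n, hn, hnB⟩ := hz1 B hB m ⟨q, hqB, hq⟩
  exact ⟨n, hn, hBV hnB⟩

/-! ### Classification and count of the attractors -/

theorem diagonal_congr (hJ : IsIntervalCycle (tent μ) N J) {d e : ℕ} (h : d ≡ e [MOD N]) :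
    diagonal J d = diagonal J e :=
  iUnion_congr fun i => by rw [hJ.congr (h.add_left i)]

/-- Every attractor is one of the sets `diagonal J d`. -/
theorem exists_eq_diagonal (hJ : IsIntervalCycle (tent μ) N J) {A : Set Plane}
    (hA : IsAttractor square (tentProduct μ) A) : ∃ d < N, A = diagonal J d := by
  obtain ⟨U, hU, hUne, hUs⟩ := hA.stable
  obtain ⟨k, i, j, hk⟩ := hJ.exists_covering_of_isOpen hU hUne
  replace hk := hk k le_rfl
  obtain ⟨d, -, hd⟩ := exists_add_modEq hJ.pos (i + k) (j + k) 0
  refine ⟨d % N, Nat.mod_lt _ hJ.pos, ?_⟩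
  rw [hJ.diagonal_congr (Nat.mod_modEq d N)]
  rw [← hJ.congr hd] at hk
  obtain ⟨z, hzd, hz, -⟩ := hJ.exists_generic_point d
  have hbox := box_subset_diagonal J (i + k) d
  obtain ⟨m, -, hm⟩ := hz (interior (box (J (i + k)) (J (i + k + d)))) isOpen_interior
    ((hJ.interior_inter_nonempty _ _).mono fun p hp => ⟨hp, hbox (interior_subset hp)⟩) 0
  -- The orbit of `p`, a point of the basin of `A`, joins the orbit of the generic point `z`.
  obtain ⟨p, hp, hpm⟩ := hk (interior_subset hm)
  have hlim := (hUs hp).2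
  -- The common tail of these orbits approaches `A` and returns arbitrarily late near every point of
  -- `diagonal J d`.
  have hsub : diagonal J d ⊆ A := by
    intro w hw
    rw [← hA.isCompact.isClosed.closure_eq, Metric.mem_closure_iff_infDist_zero hA.nonempty]
    refine le_antisymm (le_of_forall_pos_le_add fun ε hε => ?_) Metric.infDist_nonneg
    obtain ⟨M, hM⟩ := eventually_atTop.1 (hlim.eventually (gt_mem_nhds (half_pos hε)))
    obtain ⟨n, hn, hnw⟩ := hz (Metric.ball w (ε / 2)) Metric.isOpen_ball
      ⟨w, Metric.mem_ball_self (half_pos hε), hw⟩ (M + m)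
    have hn' : (tentProduct μ)^[n] z = (tentProduct μ)^[n - m + k] p := by
      rw [Function.iterate_add_apply, hpm, ← Function.iterate_add_apply,
        Nat.sub_add_cancel (by omega)]
    have h1 := hM (n - m + k) (by omega)
    rw [← hn'] at h1
    have h2 := Metric.infDist_le_infDist_add_dist (s := A) (x := w) (y := (tentProduct μ)^[n] z)
    rw [Metric.mem_ball'] at hnw
    linarith
  refine Subset.antisymm (fun w hw => ?_) hsub
  by_contra hwd
  -- `diagonal J d` is forward invariant with nonempty interior, so transitivity of `A` leaves no
  -- room for points outside it.
  obtain ⟨q, hq⟩ := hJ.interior_diagonal_nonempty d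
  obtain ⟨n, _, ⟨r, hr, rfl⟩, hr'⟩ := hA.transitive (interior (diagonal J d)) (diagonal J d)ᶜ
    isOpen_interior (hJ.isCompact_diagonal d).isClosed.isOpen_compl
    ⟨q, hq, hsub (interior_subset hq)⟩ ⟨w, hwd, hw⟩
  exact hr'.1 (hJ.mapsTo_diagonal d n (interior_subset hr.1))

/-- Take `x` in `J 0` and in no other interval of the cycle: the slice of `diagonal J d` over `x` is
`J d`, which determines `d` modulo `N`. -/
theorem diagonal_injOn (hJ : IsIntervalCycle (tent μ) N J) :
    InjOn (diagonal J) (Iio N) := by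
  intro d hd e he hde
  have hinf : (J 0).Infinite := (hJ.isPreconnected 0).infinite_of_nontrivial (hJ.nontrivial 0)
  have hfin : (⋃ i ∈ Finset.range N \ {0}, J 0 ∩ J i).Finite := by
    refine Set.Finite.biUnion (Finset.finite_toSet _) fun i hi => (hJ.inter 0 i ?_).finite
    simp only [Finset.coe_sdiff, Finset.coe_range, Finset.coe_singleton, Set.mem_sdiff, mem_Iio,
      mem_singleton_iff] at hi
    intro h
    rw [Nat.ModEq, Nat.zero_mod, Nat.mod_eq_of_lt hi.1] at h
    exact hi.2 h.symm
  obtain ⟨x, hx, hx'⟩ := (hinf.sdiff hfin).nonempty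
  have hsub : J (0 + d) ⊆ J (0 + e) := by
    intro y hy
    have := box_subset_diagonal J 0 d (mk_mem_box hx hy)
    rw [hde] at this
    obtain ⟨i, hi⟩ := mem_iUnion.1 this
    have hxi : x ∈ J i := hi.1
    have hyi : y ∈ J (i + e) := hi.2
    have h0 : i ≡ 0 [MOD N] := by
      by_contra h0
      refine hx' (mem_biUnion (x := i % N) ?_ ⟨hx, ?_⟩)
      · simp only [Finset.coe_sdiff, Finset.coe_range, Finset.coe_singleton, Set.mem_sdiff, mem_Iio,
          mem_singleton_iff]
        exact ⟨Nat.mod_lt _ hJ.pos, fun h => h0 (by rw [Nat.ModEq, h, Nat.zero_mod])⟩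
      · rwa [hJ.congr (Nat.mod_modEq i N)]
    rwa [← hJ.congr (h0.add_right e)]
  have := hJ.modEq_of_subset hsub
  rw [Nat.zero_add, Nat.zero_add, Nat.ModEq, Nat.mod_eq_of_lt hd, Nat.mod_eq_of_lt he] at this
  exact this

/-- With a single interval the diagonal is a single product, so covering one component is covering
everything. -/
theorem isStronglyMixingOn_diagonal (hJ : IsIntervalCycle (tent μ) 1 J) (d : ℕ) :
    IsStronglyMixingOn (tentProduct μ) (diagonal J d) := by
  refine ⟨hJ.image_diagonal d, fun U hU hUd => ?_⟩
  obtain ⟨k, i, hk⟩ := hJ.exists_covering_diagonal hU hUd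
  refine ⟨k, Subset.antisymm (((hJ.mapsTo_diagonal d k).mono_left inter_subset_right).image_subset)
    (Subset.trans (iUnion_subset fun j => ?_) (hk k le_rfl))⟩
  rw [hJ.congr (Nat.modEq_one : j ≡ i + k [MOD 1]),
    hJ.congr (Nat.modEq_one : j + d ≡ i + k + d [MOD 1])]

end IsIntervalCycle

/-! ### The derivative along orbits -/

theorem hasDerivAt_tent (μ : ℝ) {x : ℝ} (hx : x ≠ 1) :
    ∃ s, |s| = |μ| ∧ HasDerivAt (tent μ) s x := by
  rcases hx.lt_or_gt with h | h
  · refine ⟨μ, rfl, (((hasDerivAt_id x).const_mul μ).congr_of_eventuallyEq ?_).congr_deriv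
      (mul_one μ)⟩
    filter_upwards [gt_mem_nhds h] with y hy using tent_of_le (le_of_lt hy)
  · refine ⟨-μ, abs_neg μ, ((((hasDerivAt_id x).const_sub 2).const_mul μ).congr_of_eventuallyEq
      ?_).congr_deriv (by ring)⟩
    filter_upwards [lt_mem_nhds h] with y hy using tent_of_ge (le_of_lt hy)

/-- Off the two medians the derivative is diagonal with entries `±μ`, hence `μ` times an isometry.
-/
theorem hasFDerivAt_tentProduct {μ : ℝ} (hμ : 0 ≤ μ) {p : Plane} (hp : ∀ c, p c ≠ 1) :
    ∃ L : Plane →L[ℝ] Plane, HasFDerivAt (tentProduct μ) L p ∧ ∀ v, ‖L v‖ = μ * ‖v‖ := by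
  choose s hs hd using fun c => hasDerivAt_tent μ (hp c)
  refine ⟨((EuclideanSpace.equiv (Fin 2) ℝ).symm : (Fin 2 → ℝ) →L[ℝ] Plane) ∘L
    ContinuousLinearMap.pi fun c => s c • EuclideanSpace.proj c, ?_, fun v => ?_⟩
  · rw [← hasFDerivWithinAt_univ, hasFDerivWithinAt_euclidean]
    intro c
    rw [hasFDerivWithinAt_univ]
    have h1 : HasFDerivAt (fun p : Plane => p c) (EuclideanSpace.proj c : Plane →L[ℝ] ℝ) p :=
      (EuclideanSpace.proj c : Plane →L[ℝ] ℝ).hasFDerivAt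
    have h2 := (hd c).comp_hasFDerivAt p h1
    refine (h2.congr_of_eventuallyEq (Eventually.of_forall fun q => ?_)).congr_fderiv ?_
    · exact tentProduct_apply μ q c
    · ext v
      rfl
  · rw [EuclideanSpace.norm_eq, EuclideanSpace.norm_eq, ← Real.sqrt_sq hμ,
      ← Real.sqrt_mul (sq_nonneg μ), Finset.mul_sum]
    congr 1
    refine Finset.sum_congr rfl fun c _ => ?_
    change ‖s c * v c‖ ^ 2 = _
    rw [norm_mul, mul_pow, Real.norm_eq_abs (s c), hs, sq_abs]

theorem hasFDerivAt_tentProduct_iterate {μ : ℝ} (hμ : 0 ≤ μ) {p : Plane}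
    (hp : ∀ n c, (tentProduct μ)^[n] p c ≠ 1) (n : ℕ) :
    ∃ L : Plane →L[ℝ] Plane, HasFDerivAt (tentProduct μ)^[n] L p ∧ ∀ v, ‖L v‖ = μ ^ n * ‖v‖ := by
  induction n with
  | zero => exact ⟨ContinuousLinearMap.id ℝ Plane, hasFDerivAt_id p, by simp⟩
  | succ n ih =>
    obtain ⟨L, hL, hLn⟩ := ih
    obtain ⟨L', hL', hLn'⟩ := hasFDerivAt_tentProduct hμ (hp n)
    refine ⟨L' ∘L L, ?_, fun v => ?_⟩
    · rw [Function.iterate_succ']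
      exact hL'.comp p hL
    · rw [ContinuousLinearMap.comp_apply, hLn', hLn, pow_succ']
      ring

/-- Identifies the derivative within the square with the full derivative, at boundary points too. -/
theorem uniqueDiffWithinAt_square {p : Plane} (hp : p ∈ square) :
    UniqueDiffWithinAt ℝ square p := by
  refine uniqueDiffWithinAt_convex convex_square ⟨!₂[1, 1], ?_⟩ (subset_closure hp)
  exact mem_interior.2 ⟨_, fun q hq => ⟨Ioo_subset_Icc_self hq.1, Ioo_subset_Icc_self hq.2⟩,
    isOpen_box 0 2 0 2, by norm_num⟩

theorem IsIntervalCycle.isStrangeAttractorWithTwoPositiveExponents_diagonal {μ : ℝ} {N : ℕ}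
    {J : ℕ → Set ℝ} (hJ : IsIntervalCycle (tent μ) N J) (hμ : 1 < μ) (d : ℕ) :
    IsStrangeAttractorWithTwoPositiveExponents square (tentProduct μ) (diagonal J d) := by
  have hμ0 : 0 < μ := by linarith
  obtain ⟨z, hzd, hz, hne⟩ := hJ.exists_generic_point d
  have hderiv : ∀ n, DifferentiableWithinAt ℝ (tentProduct μ)^[n] square z ∧
      ∀ v, ‖fderivWithin ℝ (tentProduct μ)^[n] square z v‖ = μ ^ n * ‖v‖ := by
    intro n
    obtain ⟨L, hL, hLn⟩ := hasFDerivAt_tentProduct_iterate hμ0.le hne n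
    rw [hL.hasFDerivWithinAt.fderivWithin
      (uniqueDiffWithinAt_square (hJ.diagonal_subset_square d hzd))]
    exact ⟨hL.hasFDerivWithinAt.differentiableWithinAt, hLn⟩
  refine ⟨hJ.isAttractor_diagonal d, z, ⟨hzd, fun w hw => ?_, fun n => (hderiv n).1⟩,
    ⟨Real.log μ, Real.log_pos hμ, fun n => ?_⟩, fun v hv => ⟨Real.log μ, Real.log_pos hμ, ?_⟩⟩
  · rw [mem_closure_iff]
    intro V hV hwV
    obtain ⟨n, -, hn⟩ := hz V hV ⟨w, hwV, hw⟩ 0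
    exact ⟨_, hn, n, rfl⟩
  · have h := (fderivWithin ℝ (tentProduct μ)^[n] square z).le_opNorm (EuclideanSpace.single 0 1)
    rw [(hderiv n).2, PiLp.norm_single, norm_one, mul_one, mul_one] at h
    rwa [Real.exp_mul, Real.exp_log hμ0, Real.rpow_natCast]
  · have h1 : Tendsto (fun n : ℕ => Real.log μ + 1 / (n : ℝ) * Real.log ‖v‖) atTop
        (𝓝 (Real.log μ + 0 * Real.log ‖v‖)) :=
      tendsto_const_nhds.add (tendsto_one_div_atTop_nhds_zero_nat.mul_const _)
    rw [zero_mul, add_zero] at h1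
    refine h1.congr' ?_
    filter_upwards [eventually_ne_atTop 0] with n hn
    have hn' : (n : ℝ) ≠ 0 := Nat.cast_ne_zero.2 hn
    rw [(hderiv n).2, Real.log_mul (pow_pos hμ0 n).ne' (norm_ne_zero_iff.2 hv), Real.log_pow]
    field_simp

/-- The attractors of `tentProduct μ` are exactly the sets `diagonal J d`. -/
theorem IsIntervalCycle.setOf_isStrangeAttractor {μ : ℝ} {N : ℕ} {J : ℕ → Set ℝ}
    (hJ : IsIntervalCycle (tent μ) N J) (hμ : 1 < μ) :
    {A | IsStrangeAttractor square (tentProduct μ) A} = diagonal J '' Iio N := by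
  ext A
  constructor
  · rintro ⟨hA, -⟩
    obtain ⟨d, hd, rfl⟩ := hJ.exists_eq_diagonal hA
    exact ⟨d, hd, rfl⟩
  · rintro ⟨d, -, rfl⟩
    obtain ⟨hA, z, hz, hz', -⟩ := hJ.isStrangeAttractorWithTwoPositiveExponents_diagonal hμ d
    exact ⟨hA, z, hz, hz'⟩

/-! ### The parameter windows and the main theorem -/

theorem rpow_one_div_two_pow_pow (n : ℕ) : ((2 : ℝ) ^ ((1 : ℝ) / 2 ^ n)) ^ 2 ^ n = 2 := by
  rw [← Real.rpow_natCast, ← Real.rpow_mul (by norm_num)]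
  push_cast
  rw [div_mul_cancel₀ _ (by positivity), Real.rpow_one]

end TentProduct

theorem mainTheorem5 :
    (∀ μ : ℝ, μ ∈ Set.Ioc (Real.sqrt 2) 2 →
      ∃ A : Set TentProduct.Plane,
        TentProduct.IsStrangeAttractorWithTwoPositiveExponents TentProduct.square
          (TentProduct.tentProduct μ) A ∧
        TentProduct.IsStronglyMixingOn (TentProduct.tentProduct μ) A) ∧
    (∀ (n : ℕ) (μ : ℝ),
      μ ∈ Set.Ioc ((2 : ℝ) ^ ((1 : ℝ) / 2 ^ (n + 1))) ((2 : ℝ) ^ ((1 : ℝ) / 2 ^ n)) →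
      TentProduct.IsRenormalizableTimes TentProduct.IsRestrictiveDomain TentProduct.square n
        (TentProduct.tentProduct μ) ∧
      (μ < (2 : ℝ) ^ ((1 : ℝ) / 2 ^ n) →
        TentProduct.IsRenormalizableTimes TentProduct.IsStrictlyRestrictiveDomain
          TentProduct.square n (TentProduct.tentProduct μ)) ∧
      {A : Set TentProduct.Plane | TentProduct.IsStrangeAttractor TentProduct.square
        (TentProduct.tentProduct μ) A}.encard = 2 ^ n ∧
      ∀ A : Set TentProduct.Plane,
        TentProduct.IsStrangeAttractor TentProduct.square (TentProduct.tentProduct μ) A →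
        TentProduct.IsStrangeAttractorWithTwoPositiveExponents TentProduct.square
          (TentProduct.tentProduct μ) A) := by
  refine ⟨fun μ hμ => ?_, fun n μ hμ => ?_⟩
  · have hs : 2 < μ ^ 2 := (Real.sqrt_lt' ((Real.sqrt_nonneg 2).trans_lt hμ.1)).1 hμ.1
    have h1 : 1 < μ := (Real.lt_sqrt zero_le_one).2 (by norm_num) |>.trans hμ.1
    have hJ := TentProduct.isIntervalCycle_core h1 hμ.2 hs
    exact ⟨_, hJ.isStrangeAttractorWithTwoPositiveExponents_diagonal h1 0,
      hJ.isStronglyMixingOn_diagonal 0⟩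
  · have h1 : 1 < μ := (Real.one_lt_rpow one_lt_two (by positivity)).trans hμ.1
    have hn : μ ^ 2 ^ n ≤ 2 := by
      rw [← TentProduct.rpow_one_div_two_pow_pow n]
      exact pow_le_pow_left₀ (by linarith) hμ.2 _
    have hn' : 2 < μ ^ 2 ^ (n + 1) := by
      rw [← TentProduct.rpow_one_div_two_pow_pow (n + 1)]
      exact pow_lt_pow_left₀ hμ.1 (by positivity) (by positivity)
    -- This gives `c = μ - 1 ≤ 1`, needed to start the renormalization from the tent map itself.
    have h2 : μ ≤ 2 := (le_self_pow₀ h1.le (by positivity)).trans hn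
    obtain ⟨J, hJ⟩ := TentProduct.exists_isIntervalCycle n h1 hn hn'
    have hR := TentProduct.isRenormalizableTimes_peakProduct n h1 hn le_rfl (by linarith)
      (Γ := TentProduct.tentProduct μ)
      (by rw [TentProduct.tentProduct_eq_peakProduct]; exact fun _ _ => rfl)
    refine ⟨hR.1, fun h => hR.2 ?_, ?_, fun A hA => ?_⟩
    · rw [← TentProduct.rpow_one_div_two_pow_pow n]
      exact pow_lt_pow_left₀ h (by linarith) (by positivity)
    · rw [hJ.setOf_isStrangeAttractor h1, hJ.diagonal_injOn.encard_image, ← Finset.coe_Iio,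
        Set.encard_coe_eq_coe_finsetCard, Nat.card_Iio]
      norm_cast
    · obtain ⟨d, -, rfl⟩ := (hJ.setOf_isStrangeAttractor h1).subset hA
      exact hJ.isStrangeAttractorWithTwoPositiveExponents_diagonal h1 d
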